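/- Let $d\ge 0$. A set $\omega\subset\mathbb{R}^d$ is a Delone set if there are $0<r,R<\infty$ with $\|x-y\|\ge r$ for all distinct $x,y\in\omega$ and $\overline{B}_R(x)\cap\omega\ne\emptyset$ for all $x\in\mathbb{R}^d$, where $\overline{B}_R(x)$ is the closed Euclidean ball. A pattern is a pair $(\Lambda,Q)$ with $Q\subset\mathbb{R}^d$ bounded and $\Lambda\subset Q$ finite; a pattern class is a pattern up to translation, $(\Lambda,Q)\sim(\Lambda+t,Q+t)$. For patterns $X_i=(\Lambda_i,Q_i)$ let $\sharp_{X_1}X_2$ be the number of $t\in\mathbb{R}^d$ with $\Lambda_1+t\subset\Lambda_2$ and $Q_1+t\subset Q_2$; this depends only on the classes of $X_1$ and $X_2$. For a Delone set $\omega$ and a bounded set $Q$ write $\omega\wedge Q$ for the class of $(\omega\cap Q,Q)$. On the set $\mathcal{F}(\mathbb{R}^d)$ of closed subsets of $\mathbb{R}^d$ consider the natural topology, which has the sets $\{G: d_k(F,G)\le\varepsilon\}$ ($\varepsilon>0$, $k\in\mathbb{N}$) as a neighbourhood basis at $F$, where $$d_k(F,G)=\inf\big(\{\varepsilon>0: F\cap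 \overline{B}_k(0)\subset U_\varepsilon(G),\ G\cap \overline{B}_k(0)\subset U_\varepsilon(F)\}\cup\{1\}\big)$$ and $U_\varepsilon$ denotes the open $\varepsilon$-neighbourhood. A Delone dynamical system of finite type (DDSF) is a set $\Omega\subset\mathcal{F}(\mathbb{R}^d)$ of Delone sets that is closed in the natural topology, invariant under all translations $T_t\omega=\omega+t$, $t\in\mathbb{R}^d$, and such that for every $s>0$ the set of pattern classes $\{\omega\wedge \overline{B}_s(x):\omega\in\Omega,\ x\in\omega\}$ is finite. It is uniquely ergodic if there is exactly one $T$-invariant Borel probability measure on $\Omega$. A van Hove sequence is a sequence $(Q_n)$ of bounded measurable subsets of $\mathbb{R}^d$ with Lebesgue measure $|Q_n|>0$ such that $|\partial_sQ_n|/|Q_n|\to0$ as $n\to\infty$ for every $s>0$, where $\partial_sQ$ is the set of points at distance less than $s$ from the boundary of $Q$. **Theorem.** Let $\Omega$ be a nonempty DDSF. Then $\Omega$ is uniquely ergodic if and only if, for every pattern class $P=[(\Lambda,Q)]$ with $\Lambda\neq\emptyset$ and every van Hove sequence $(Q_n)$, there is a number $c\in\mathbb{R}$ (the frequency of $P$)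 such that $$\lim_{n\to\infty}|Q_n|^{-1}\,\sharp_P(\omega\wedge Q_n)=c\qquad\text{uniformly in }\omega\in\Omega .$$ -/

import Mathlib

open Set Filter Topology MeasureTheory

noncomputable section

namespace DeloneDyn

/-- Euclidean space `ℝ^d`, with the Euclidean norm and Lebesgue measure. -/
abbrev E (d : ℕ) : Type := EuclideanSpace ℝ (Fin d)

/-- The translate `A + t`. -/
def shift {d : ℕ} (t : E d) (A : Set (E d)) : Set (E d) := (fun x => x + t) '' A

theorem shift_zero {d : ℕ} (A : Set (E d)) : shift 0 A = A := by
  simp [shift]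

theorem shift_shift {d : ℕ} (s t : E d) (A : Set (E d)) :
    shift s (shift t A) = shift (t + s) A := by
  simp only [shift, image_image, add_assoc]

theorem shift_subset_shift {d : ℕ} (t : E d) {A B : Set (E d)} :
    shift t A ⊆ shift t B ↔ A ⊆ B :=
  image_subset_image_iff (add_left_injective t)

/-! ### Delone sets -/

/-- `ω` is an `(r,R)`-set. -/
def IsRRSet {d : ℕ} (r R : ℝ) (ω : Set (E d)) : Prop :=
  (∀ x ∈ ω, ∀ y ∈ ω, x ≠ y → r ≤ ‖x - y‖) ∧
    ∀ x : E d, (Metric.closedBall x R ∩ ω).Nonempty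

/-- `ω` is a Delone set. -/
def IsDelone {d : ℕ} (ω : Set (E d)) : Prop :=
  ∃ r R : ℝ, 0 < r ∧ 0 < R ∧ IsRRSet r R ω

/-- A Delone set has only finitely many points in a bounded set. -/
theorem IsDelone.finite_inter {d : ℕ} {ω : Set (E d)} (hω : IsDelone ω) {Q : Set (E d)}
    (hQ : Bornology.IsBounded Q) : (ω ∩ Q).Finite := by
  obtain ⟨r, R, hr, -, hsep, -⟩ := hω
  refine Set.not_infinite.1 fun hinf => ?_
  obtain ⟨x, hx, y, hy, hxy, hlt⟩ :
      ∃ x ∈ ω ∩ Q, ∃ y ∈ ω ∩ Q, x ≠ y ∧ dist x y < r := by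
    have htb : TotallyBounded (ω ∩ Q) := (Metric.isCompact_of_isClosed_isBounded isClosed_closure hQ.closure).totallyBounded.subset
        (inter_subset_right.trans subset_closure)
    obtain ⟨t, ht, hcov⟩ := Metric.totallyBounded_iff.1 htb (r / 2) (half_pos hr)
    have hmaps : ∀ x ∈ ω ∩ Q, ∃ c ∈ t, x ∈ Metric.ball c (r / 2) := by
      intro x hx
      simpa using hcov hx
    choose! f hft hfb using hmaps
    obtain ⟨x, hx, y, hy, hne, hfe⟩ := hinf.exists_ne_map_eq_of_mapsTo (f := f) hft ht
    refine ⟨x, hx, y, hy, hne, ?_⟩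
    have h1 := Metric.mem_ball.1 (hfb x hx)
    have h2 := Metric.mem_ball.1 (hfb y hy)
    rw [← hfe] at h2
    linarith [dist_triangle_right x y (f x)]
  have := hsep x hx.1 y hy.1 hxy
  rw [dist_eq_norm] at hlt
  linarith

/-! ### Patterns and pattern classes -/

/-- A pattern `(Λ, Q)`: a bounded set `Q` and a finite subset `Λ` of `Q`. -/
structure Pattern (d : ℕ) where
  points : Set (E d)
  support : Set (E d)
  finite : points.Finite
  isBounded : Bornology.IsBounded support
  subset : points ⊆ support

/-- The number `♯_{X₁} X₂` of occurrences of `X₁` in `X₂`.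
It is a genuine (finite) count as soon as `X₁` contains at least one point, see
`Pattern.finite_occurrenceSet`. -/
def Pattern.occurrences {d : ℕ} (X₁ X₂ : Pattern d) : ℕ :=
  {t : E d | shift t X₁.points ⊆ X₂.points ∧ shift t X₁.support ⊆ X₂.support}.ncard

theorem Pattern.finite_occurrenceSet {d : ℕ} (X₁ X₂ : Pattern d) (h : X₁.points.Nonempty) :
    {t : E d | shift t X₁.points ⊆ X₂.points ∧ shift t X₁.support ⊆ X₂.support}.Finite := by
  obtain ⟨x, hx⟩ := h
  refine (X₂.finite.image fun y => y - x).subset fun t ht => ?_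
  exact ⟨x + t, ht.1 ⟨x, hx, rfl⟩, by simp⟩

/-- Patterns are equivalent if they are translates of each other. -/
instance patternSetoid (d : ℕ) : Setoid (Pattern d) where
  r X₁ X₂ := ∃ t : E d, X₁.points = shift t X₂.points ∧ X₁.support = shift t X₂.support
  iseqv :=
    { refl := fun X => ⟨0, by simp [shift_zero]⟩
      symm := by
        rintro X Y ⟨t, h₁, h₂⟩
        exact ⟨-t, by simp [h₁, shift_shift, shift_zero], by simp [h₂, shift_shift, shift_zero]⟩
      trans := by
        rintro X Y Z ⟨t, h₁, h₂⟩ ⟨s, h₃, h₄⟩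
        exact ⟨s + t, by rw [h₁, h₃, shift_shift], by rw [h₂, h₄, shift_shift]⟩ }

/-- Pattern classes: patterns up to translation. -/
def PatternClass (d : ℕ) : Type := Quotient (patternSetoid d)

theorem occurrences_congr {d : ℕ} (X₁ X₂ Y₁ Y₂ : Pattern d) (h₁ : X₁ ≈ Y₁) (h₂ : X₂ ≈ Y₂) :
    X₁.occurrences X₂ = Y₁.occurrences Y₂ := by
  obtain ⟨a, ha₁, ha₂⟩ := h₁
  obtain ⟨b, hb₁, hb₂⟩ := h₂
  have key : ∀ (t : E d) (A B : Set (E d)),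
      shift t (shift a A) ⊆ shift b B ↔ shift (t + (a - b)) A ⊆ B := by
    intro t A B
    rw [← shift_subset_shift b (A := shift (t + (a - b)) A), shift_shift, shift_shift]
    have : a + t = t + (a - b) + b := by abel
    rw [this]
  unfold Pattern.occurrences
  rw [ha₁, ha₂, hb₁, hb₂]
  simp only [key]
  rw [← Set.ncard_image_of_injective _ (add_left_injective (a - b))]
  congr 1
  ext t
  simp only [mem_image, mem_ofPred_eq]
  constructor
  · rintro ⟨s, hs, rfl⟩
    exact hs
  · intro ht
    exact ⟨t - (a - b), by simpa using ht, by simp⟩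

/-- The number `♯_P P'` of occurrences, for pattern classes. -/
def PatternClass.occurrences {d : ℕ} (P P' : PatternClass d) : ℕ :=
  Quotient.liftOn₂ P P' Pattern.occurrences occurrences_congr

/-- The pattern class `P = [(Λ, Q)]` contains a point, i.e. `Λ ≠ ∅`. -/
def PatternClass.HasPoint {d : ℕ} (P : PatternClass d) : Prop :=
  Quotient.liftOn P (fun X => X.points.Nonempty) fun X Y h => by
    obtain ⟨t, h₁, -⟩ := h
    simp only [h₁, shift, image_nonempty]

/-- The pattern class `ω ∧ Q = [(ω ∩ Q, Q)]`. -/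
def wedge {d : ℕ} (ω : Set (E d)) (hω : IsDelone ω) (Q : Set (E d))
    (hQ : Bornology.IsBounded Q) : PatternClass d :=
  Quotient.mk (patternSetoid d)
    { points := ω ∩ Q
      support := Q
      finite := hω.finite_inter hQ
      isBounded := hQ
      subset := inter_subset_right }

/-- The set of classes of ball patterns of radius `s` of `ω`. -/
def ballPatternClasses {d : ℕ} (ω : Set (E d)) (hω : IsDelone ω) (s : ℝ) :
    Set (PatternClass d) :=
  {P | ∃ x ∈ ω, P = wedge ω hω (Metric.closedBall x s) Metric.isBounded_closedBall}

/-! ### The natural topology on the closed subsets of `ℝ^d` -/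

/-- The closed subsets of `ℝ^d`. This is a separate type, since Mathlib equips
`TopologicalSpace.Closeds` with another topology. -/
def ClosedSubset (d : ℕ) : Type := TopologicalSpace.Closeds (E d)

instance (d : ℕ) : SetLike (ClosedSubset d) (E d) :=
  inferInstanceAs (SetLike (TopologicalSpace.Closeds (E d)) (E d))

/-- The action of `ℝ^d` on closed sets, `T_t G = G + t`. -/
def translate {d : ℕ} (t : E d) (G : ClosedSubset d) : ClosedSubset d :=
  ⟨shift t (G : Set (E d)),
    (Homeomorph.addRight t).isClosedMap _ (TopologicalSpace.Closeds.isClosed (α := E d) G)⟩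

/-- The numbers `ε > 0` such that the parts of `F` and `G` in the ball `B_k` lie in the open
`ε`-neighbourhoods of `G` and `F`. -/
def closeRadii {d : ℕ} (k : ℕ) (F G : ClosedSubset d) : Set ℝ :=
  {ε : ℝ | 0 < ε ∧
    (F : Set (E d)) ∩ Metric.closedBall 0 k ⊆ Metric.thickening ε (G : Set (E d)) ∧
    (G : Set (E d)) ∩ Metric.closedBall 0 k ⊆ Metric.thickening ε (F : Set (E d))}

/-- `d_k(F, G)`. -/
def localDist {d : ℕ} (k : ℕ) (F G : ClosedSubset d) : ℝ :=
  sInf (closeRadii k F G ∪ {1})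

/-- The basic neighbourhood `U_{ε,k}(F)`. -/
def basicNhd {d : ℕ} (ε : ℝ) (k : ℕ) (F : ClosedSubset d) : Set (ClosedSubset d) :=
  {G | localDist k F G ≤ ε}

theorem localDist_mono {d : ℕ} {k l : ℕ} (h : k ≤ l) (F G : ClosedSubset d) :
    localDist k F G ≤ localDist l F G := by
  have hb : Metric.closedBall (0 : E d) k ⊆ Metric.closedBall 0 l :=
    Metric.closedBall_subset_closedBall (by exact_mod_cast h)
  refine csInf_le_csInf ⟨0, ?_⟩ ⟨1, Or.inr rfl⟩ ?_
  · rintro ε (hε | rfl)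
    · exact hε.1.le
    · exact zero_le_one
  · refine union_subset_union_left _ fun ε hε => ⟨hε.1, ?_, ?_⟩
    · exact (inter_subset_inter_right _ hb).trans hε.2.1
    · exact (inter_subset_inter_right _ hb).trans hε.2.2

/-- The natural topology: a set is open if with each `F` it contains some `U_{ε,k}(F)`. -/
instance naturalTopology (d : ℕ) : TopologicalSpace (ClosedSubset d) where
  IsOpen S := ∀ F ∈ S, ∃ ε : ℝ, 0 < ε ∧ ∃ k : ℕ, basicNhd ε k F ⊆ S
  isOpen_univ := fun F _ => ⟨1, one_pos, 0, subset_univ _⟩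
  isOpen_inter := by
    rintro S S' hS hS' F ⟨hF, hF'⟩
    obtain ⟨ε, hε, k, hk⟩ := hS F hF
    obtain ⟨ε', hε', k', hk'⟩ := hS' F hF'
    refine ⟨min ε ε', lt_min hε hε', max k k', fun G hG => ⟨hk ?_, hk' ?_⟩⟩
    · exact (localDist_mono (le_max_left k k') F G).trans (le_trans hG (min_le_left _ _))
    · exact (localDist_mono (le_max_right k k') F G).trans (le_trans hG (min_le_right _ _))
  isOpen_sUnion := by
    rintro 𝒮 h𝒮 F ⟨S, hS, hF⟩
    obtain ⟨ε, hε, k, hk⟩ := h𝒮 S hS F hF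
    exact ⟨ε, hε, k, hk.trans (subset_sUnion_of_mem hS)⟩

/-- The Borel σ-algebra of the natural topology. -/
instance (d : ℕ) : MeasurableSpace (ClosedSubset d) := borel _

instance (d : ℕ) : BorelSpace (ClosedSubset d) := ⟨rfl⟩

/-! ### Delone dynamical systems -/

/-- `(Ω, T)` is a Delone dynamical system. -/
structure IsDDS {d : ℕ} (Ω : Set (ClosedSubset d)) : Prop where
  isDelone : ∀ ω ∈ Ω, IsDelone (ω : Set (E d))
  translate_mem : ∀ t : E d, ∀ ω ∈ Ω, translate t ω ∈ Ω
  isClosed : IsClosed Ω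

/-- `(Ω, T)` is a Delone dynamical system of finite type. -/
structure IsDDSF {d : ℕ} (Ω : Set (ClosedSubset d)) : Prop extends IsDDS Ω where
  finite_type : ∀ s : ℝ, 0 < s →
    (⋃ ω : Ω, ballPatternClasses (ω.1 : Set (E d)) (isDelone ω.1 ω.2) s).Finite

/-- The action `T_t` on `Ω`. -/
def IsDDS.map {d : ℕ} {Ω : Set (ClosedSubset d)} (hΩ : IsDDS Ω) (t : E d) (ω : Ω) : Ω :=
  ⟨translate t ω.1, hΩ.translate_mem t ω.1 ω.2⟩

/-- There is exactly one `T`-invariant Borel probability measure on `Ω`. -/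
def IsDDS.UniquelyErgodic {d : ℕ} {Ω : Set (ClosedSubset d)} (hΩ : IsDDS Ω) : Prop :=
  ∃! μ : Measure Ω, IsProbabilityMeasure μ ∧ ∀ t : E d, MeasurePreserving (hΩ.map t) μ μ

/-! ### Van Hove sequences -/

/-- A van Hove sequence of bounded (measurable) sets of positive volume. Here
`Metric.thickening s (frontier Q)` is the set of points at distance less than `s` from the
boundary of `Q`. -/
structure IsVanHove {d : ℕ} (Q : ℕ → Set (E d)) : Prop where
  isBounded : ∀ n, Bornology.IsBounded (Q n)
  measurableSet : ∀ n, MeasurableSet (Q n)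
  volume_pos : ∀ n, 0 < volume (Q n)
  tendsto : ∀ s : ℝ, 0 < s →
    Tendsto (fun n => volume (Metric.thickening s (frontier (Q n))) / volume (Q n)) atTop (𝓝 0)

end DeloneDyn

end

open DeloneDyn

/-!
The topology of `Ω` is governed by the distance functions `ω ↦ dist(q, ω)`. They are continuous,
and `Ω` is compact because every ultrafilter of closed sets has a limit
(`exists_forall_basicNhd_mem`). The distances to a dense sequence therefore embed `Ω` into a
metrizable space (`isClosedEmbedding_distSeq`), and `ℝ^d` acts continuously. Two consequences for
the averages `|Q|⁻¹ ∫_Q g(ω - t) dt` are used: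

* an ultrafilter limit of averages over a van Hove sequence is, by the Riesz-Markov-Kakutani
  theorem, the integral of an invariant probability measure (`exists_invariant_tendsto_average`).
  Hence invariant measures exist, and unique ergodicity makes the averages of every continuous
  function converge uniformly (`tendstoUniformly_average_of_uniquelyErgodic`);
* conversely, if the averages of `g` converge uniformly to `c`, then every invariant probability
  measure gives `g` the integral `c` (`integral_eq_of_tendstoUniformly_average`), by Fubini.

Averages and pattern counts are linked by the observables `coneProd`, which are products of
functions `ω ↦ max 0 (η - dist(q, ω))`. They are visibly continuous, and they are also sums over
patterns: by finite local complexity the distances within all `ω ∈ Ω` are bounded below, so for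
small `η` each factor sees at most one point of `ω`, and the differences of the points seen by the
factors range over a finite set. So along an orbit `coneProd` is a finite sum, over configurations
`v`, of translates of a bump function centred at the places where `ω` contains `{0} ∪ {v i}`
(`coneProd_map_neg_eq_sum`). Its averages are then linear combinations of pattern frequencies, up
to an error that is controlled by the volume of the boundary layer
(`exists_abs_average_coneProd_sub_le`).

For a given pattern, cones of small radius at its points leave a single configuration in this sum
(`exists_abs_average_sub_frequency_le`). So uniform convergence of averages gives uniform
convergence of the frequency. Conversely, existence of all frequencies determines the integrals of
all `coneProd` (`integral_coneProd_eq`). Together with the constants these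
span an algebra that separates the points of `Ω`,
so the Stone-Weierstrass theorem gives uniqueness of the invariant measure
(`eq_of_integral_coneProd_eq`).
-/

noncomputable section

namespace DeloneDyn

variable {d : ℕ}

/-! ### The natural topology on a Delone dynamical system -/

theorem ClosedSubset.isClosed_coe (F : ClosedSubset d) : IsClosed (F : Set (E d)) :=
  TopologicalSpace.Closeds.isClosed (α := E d) F

theorem localDist_le {k : ℕ} {F G : ClosedSubset d} {ε : ℝ} (h : ε ∈ closeRadii k F G) :
    localDist k F G ≤ ε := by
  refine csInf_le ⟨0, ?_⟩ (Or.inl h)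
  rintro δ (hδ | rfl)
  · exact hδ.1.le
  · exact zero_le_one

theorem mem_closeRadii_of_localDist_lt {k : ℕ} {F G : ClosedSubset d} {ε : ℝ}
    (h : localDist k F G < ε) (h1 : ε ≤ 1) : ε ∈ closeRadii k F G := by
  obtain ⟨δ, hδ, hδε⟩ := exists_lt_of_csInf_lt (s := closeRadii k F G ∪ {1}) ⟨1, Or.inr rfl⟩ h
  rcases hδ with hδ | rfl
  · exact ⟨hδ.1.trans hδε, hδ.2.1.trans (Metric.thickening_mono hδε.le _),
      hδ.2.2.trans (Metric.thickening_mono hδε.le _)⟩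
  · exact absurd hδε (not_lt.2 h1)

/-- Every ultrafilter of closed sets converges in the natural topology, to the set of points all
of whose neighbourhoods are met by almost all members. -/
theorem exists_forall_basicNhd_mem (U : Ultrafilter (ClosedSubset d)) :
    ∃ F : ClosedSubset d, ∀ ε : ℝ, 0 < ε → ∀ k : ℕ, basicNhd ε k F ∈ U := by
  have hclosed : IsClosed {x : E d | ∀ ε : ℝ, 0 < ε →
      {G : ClosedSubset d | ((G : Set (E d)) ∩ Metric.ball x ε).Nonempty} ∈ U} := by
    refine isClosed_of_closure_subset fun x hx ε hε => ?_
    obtain ⟨y, hy, hxy⟩ := Metric.mem_closure_iff.1 hx (ε / 2) (half_pos hε)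
    refine mem_of_superset (hy (ε / 2) (half_pos hε)) fun G hG => hG.mono ?_
    refine inter_subset_inter_right _ (Metric.ball_subset_ball' ?_)
    rw [dist_comm]
    linarith
  let F : ClosedSubset d := (⟨_, hclosed⟩ : TopologicalSpace.Closeds (E d))
  have hmem : ∀ x : E d, x ∈ (F : Set (E d)) ↔ ∀ ε : ℝ, 0 < ε →
      {G : ClosedSubset d | ((G : Set (E d)) ∩ Metric.ball x ε).Nonempty} ∈ U := fun x => Iff.rfl
  refine ⟨F, fun ε hε k => ?_⟩
  have h1 : ∀ᶠ G : ClosedSubset d in (U : Filter (ClosedSubset d)),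
      (F : Set (E d)) ∩ Metric.closedBall 0 k ⊆ Metric.thickening ε (G : Set (E d)) := by
    have hc : IsCompact ((F : Set (E d)) ∩ Metric.closedBall 0 k) :=
      (isCompact_closedBall _ _).inter_left F.isClosed_coe
    obtain ⟨T, hT, hTfin, hcov⟩ := hc.elim_finite_subcover_image (b := (F : Set (E d)))
      (c := fun x => Metric.ball x (ε / 2)) (fun _ _ => Metric.isOpen_ball)
      (fun x hx => mem_biUnion hx.1 (Metric.mem_ball_self (half_pos hε)))
    filter_upwards [(hTfin.eventually_all (l := (U : Filter (ClosedSubset d)))).2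
      fun x hx => (hmem x).1 (hT hx) (ε / 2) (half_pos hε)] with G hG z hz
    obtain ⟨x, hx, hzx⟩ := mem_iUnion₂.1 (hcov hz)
    obtain ⟨y, hy, hyx⟩ := hG x hx
    refine Metric.mem_thickening_iff.2 ⟨y, hy, ?_⟩
    have a1 := Metric.mem_ball.1 hzx
    have a2 := Metric.mem_ball.1 hyx
    linarith [dist_triangle_right z y x]
  have h2 : ∀ᶠ G : ClosedSubset d in (U : Filter (ClosedSubset d)),
      (G : Set (E d)) ∩ Metric.closedBall 0 k ⊆ Metric.thickening ε (F : Set (E d)) := by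
    have hc : IsCompact (Metric.closedBall (0 : E d) k \ Metric.thickening ε (F : Set (E d))) :=
      (isCompact_closedBall _ _).diff Metric.isOpen_thickening
    have hex : ∀ x ∈ Metric.closedBall (0 : E d) k \ Metric.thickening ε (F : Set (E d)),
        ∃ δ : ℝ, 0 < δ ∧ ∀ᶠ G : ClosedSubset d in (U : Filter (ClosedSubset d)),
          ¬ ((G : Set (E d)) ∩ Metric.ball x δ).Nonempty := by
      intro x hx
      have hxF : x ∉ (F : Set (E d)) := fun h => hx.2 (Metric.self_subset_thickening hε _ h)
      rw [hmem] at hxF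
      push Not at hxF
      obtain ⟨δ, hδ, hδU⟩ := hxF
      exact ⟨δ, hδ, Ultrafilter.eventually_not.2 hδU⟩
    choose! δ hδ hδU using hex
    obtain ⟨T, hT, hTfin, hcov⟩ := hc.elim_finite_subcover_image
      (b := Metric.closedBall (0 : E d) k \ Metric.thickening ε (F : Set (E d)))
      (c := fun x => Metric.ball x (δ x)) (fun _ _ => Metric.isOpen_ball)
      (fun x hx => mem_biUnion hx (Metric.mem_ball_self (hδ x hx)))
    filter_upwards [(hTfin.eventually_all (l := (U : Filter (ClosedSubset d)))).2
      fun x hx => hδU x (hT hx)] with G hG z hz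
    by_contra hzF
    obtain ⟨x, hx, hzx⟩ := mem_iUnion₂.1 (hcov ⟨hz.2, hzF⟩)
    exact hG x hx ⟨z, hz.1, hzx⟩
  filter_upwards [h1, h2] with G hG1 hG2
  exact localDist_le ⟨hε, hG1, hG2⟩

theorem isCompact_of_isClosed {Ω : Set (ClosedSubset d)} (hΩ : IsClosed Ω) : IsCompact Ω := by
  refine isCompact_iff_ultrafilter_le_nhds'.2 fun U hU => ?_
  obtain ⟨F, hF⟩ := exists_forall_basicNhd_mem U
  have hle : (U : Filter (ClosedSubset d)) ≤ 𝓝 F := by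
    intro S hS
    obtain ⟨V, hVS, hV, hFV⟩ := mem_nhds_iff.1 hS
    obtain ⟨ε, hε, k, hk⟩ := hV F hFV
    exact mem_of_superset (hF ε hε k) (hk.trans hVS)
  refine ⟨F, ?_, hle⟩
  by_contra hFΩ
  have : Ωᶜ ∈ U := hle (hΩ.isOpen_compl.mem_nhds hFΩ)
  exact (Ultrafilter.compl_mem_iff_notMem.1 this) hU

/-- If two closed sets are close on a large ball, their distances to a point `x` are close. -/
theorem infDist_le_of_mem_closeRadii {k : ℕ} {F G : ClosedSubset d} {ε : ℝ} {x p : E d}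
    (h : ε ∈ closeRadii k F G) (hp : p ∈ (F : Set (E d)))
    (hpk : p ∈ Metric.closedBall (0 : E d) k) :
    Metric.infDist x (G : Set (E d)) < dist x p + ε := by
  obtain ⟨y, hy, hpy⟩ := Metric.mem_thickening_iff.1 (h.2.1 ⟨hp, hpk⟩)
  have := Metric.infDist_le_dist_of_mem (x := x) hy
  linarith [dist_triangle x p y]

theorem closeRadii_comm {k : ℕ} {F G : ClosedSubset d} {ε : ℝ} (h : ε ∈ closeRadii k F G) :
    ε ∈ closeRadii k G F := ⟨h.1, h.2.2, h.2.1⟩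

/-- The natural topology is defined so that a map is continuous as soon as it sends basic sets
into prescribed neighbourhoods. -/
theorem continuous_of_basicNhd {X : Type*} [TopologicalSpace X] {Ω : Set (ClosedSubset d)}
    (hΩ : IsClosed Ω) (f : Ω → X)
    (hf : ∀ F : Ω, ∀ V ∈ 𝓝 (f F), ∃ ε : ℝ, 0 < ε ∧ ∃ k : ℕ, ∀ G : Ω,
      (G : ClosedSubset d) ∈ basicNhd ε k F → f G ∈ V) : Continuous f := by
  refine continuous_def.2 fun V hV => ?_
  have hopen : IsOpen (Ωᶜ ∪ Subtype.val '' (f ⁻¹' V)) := by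
    rintro F (hF | ⟨F, hF, rfl⟩)
    · obtain ⟨ε, hε, k, hk⟩ := hΩ.isOpen_compl F hF
      exact ⟨ε, hε, k, hk.trans subset_union_left⟩
    · obtain ⟨ε, hε, k, hk⟩ := hf F V (hV.mem_nhds hF)
      refine ⟨ε, hε, k, fun G hG => ?_⟩
      by_cases hGΩ : G ∈ Ω
      · exact Or.inr ⟨⟨G, hGΩ⟩, hk ⟨G, hGΩ⟩ hG, rfl⟩
      · exact Or.inl hGΩ
  convert hopen.preimage continuous_subtype_val using 1
  ext F
  simp

theorem IsDelone.nonempty {ω : Set (E d)} (h : IsDelone ω) : ω.Nonempty := by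
  obtain ⟨r, R, -, -, -, h⟩ := h
  exact (h 0).mono inter_subset_right

theorem continuous_infDist {Ω : Set (ClosedSubset d)} (hΩ : IsDDS Ω) (x : E d) :
    Continuous fun ω : Ω => Metric.infDist x (ω.1 : Set (E d)) := by
  refine continuous_of_basicNhd hΩ.isClosed _ fun F V hV => ?_
  obtain ⟨δ, hδ, hδV⟩ := Metric.mem_nhds_iff.1 hV
  obtain ⟨p, hp, hpx⟩ :=
    F.1.isClosed_coe.exists_infDist_eq_dist (hΩ.isDelone F.1 F.2).nonempty x
  -- `k` is so large that nearest points to `x` in `F` and in any nearby `G` lie in the ball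
  obtain ⟨k, hk⟩ := exists_nat_ge (‖x‖ + dist x p + 2)
  set ε := min (1 / 2) (δ / 2) with hε
  have hε0 : 0 < ε := by positivity
  refine ⟨ε, hε0, k, fun G hG => hδV ?_⟩
  have hε1 : ε ≤ 1 / 2 := min_le_left _ _
  have hεδ : ε ≤ δ / 2 := min_le_right _ _
  -- `localDist` is an infimum that need not be attained, hence the slack between `ε` and `η`
  obtain ⟨η, hη1, hη2⟩ : ∃ η, ε < η ∧ η < 2 * ε := exists_between (by linarith)
  have hmem : η ∈ closeRadii k F.1 G.1 :=
    mem_closeRadii_of_localDist_lt (lt_of_le_of_lt hG hη1) (by linarith)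
  have hpk : p ∈ Metric.closedBall (0 : E d) k := by
    rw [mem_closedBall_zero_iff]
    have := norm_le_norm_add_norm_sub' p x
    rw [← dist_eq_norm, dist_comm] at this
    linarith
  have h1 := infDist_le_of_mem_closeRadii (x := x) hmem hp hpk
  obtain ⟨q, hq, hqx⟩ :=
    G.1.isClosed_coe.exists_infDist_eq_dist (hΩ.isDelone G.1 G.2).nonempty x
  have hqk : q ∈ Metric.closedBall (0 : E d) k := by
    rw [mem_closedBall_zero_iff]
    have := norm_le_norm_add_norm_sub' q x
    rw [← dist_eq_norm, dist_comm] at this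
    linarith
  have h2 := infDist_le_of_mem_closeRadii (x := x) (closeRadii_comm hmem) hq hqk
  rw [Metric.mem_ball, Real.dist_eq, abs_lt]
  constructor <;> linarith

/-- The distances to the points of a dense sequence, as a map into `ℕ → ℝ`. -/
def distSeq (Ω : Set (ClosedSubset d)) (ω : Ω) (n : ℕ) : ℝ :=
  Metric.infDist (TopologicalSpace.denseSeq (E d) n) (ω.1 : Set (E d))

theorem continuous_distSeq {Ω : Set (ClosedSubset d)} (hΩ : IsDDS Ω) :
    Continuous (distSeq Ω) :=
  continuous_pi fun _ => continuous_infDist hΩ _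

theorem injective_distSeq {Ω : Set (ClosedSubset d)} (hΩ : IsDDS Ω) :
    Function.Injective (distSeq Ω) := by
  intro F G h
  have h' : (fun x : E d => Metric.infDist x (F.1 : Set (E d))) =
      fun x => Metric.infDist x (G.1 : Set (E d)) :=
    (TopologicalSpace.denseRange_denseSeq (E d)).equalizer (Metric.continuous_infDist_pt _)
      (Metric.continuous_infDist_pt _) h
  refine Subtype.ext (SetLike.ext fun x => ?_)
  have hF := F.1.isClosed_coe.mem_iff_infDist_zero (hΩ.isDelone F.1 F.2).nonempty (x := x)
  have hG := G.1.isClosed_coe.mem_iff_infDist_zero (hΩ.isDelone G.1 G.2).nonempty (x := x)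
  have : Metric.infDist x (F.1 : Set (E d)) = Metric.infDist x (G.1 : Set (E d)) := congrFun h' x
  rw [this, ← hG] at hF
  exact hF

theorem IsDDS.compactSpace {Ω : Set (ClosedSubset d)} (hΩ : IsDDS Ω) : CompactSpace Ω :=
  isCompact_iff_compactSpace.1 (isCompact_of_isClosed hΩ.isClosed)

theorem isClosedEmbedding_distSeq {Ω : Set (ClosedSubset d)} (hΩ : IsDDS Ω) :
    IsClosedEmbedding (distSeq Ω) :=
  have := hΩ.compactSpace
  (continuous_distSeq hΩ).isClosedEmbedding (injective_distSeq hΩ)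

theorem IsDDS.metrizableSpace {Ω : Set (ClosedSubset d)} (hΩ : IsDDS Ω) :
    TopologicalSpace.MetrizableSpace Ω :=
  (isClosedEmbedding_distSeq hΩ).isEmbedding.metrizableSpace

theorem IsDDS.secondCountableTopology {Ω : Set (ClosedSubset d)} (hΩ : IsDDS Ω) :
    SecondCountableTopology Ω :=
  (isClosedEmbedding_distSeq hΩ).isEmbedding.secondCountableTopology

theorem infDist_shift (t x : E d) (A : Set (E d)) :
    Metric.infDist x (shift t A) = Metric.infDist (x - t) A := by
  have h := Metric.infDist_image (t := A) (x := x - t) (isometry_add_right t)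
  simpa [shift] using h

theorem IsDDS.infDist_map {Ω : Set (ClosedSubset d)} (hΩ : IsDDS Ω) (t x : E d) (ω : Ω) :
    Metric.infDist x ((hΩ.map t ω).1 : Set (E d)) =
      Metric.infDist (x - t) (ω.1 : Set (E d)) :=
  infDist_shift t x _

theorem IsDDS.map_add {Ω : Set (ClosedSubset d)} (hΩ : IsDDS Ω) (s t : E d) (ω : Ω) :
    hΩ.map s (hΩ.map t ω) = hΩ.map (t + s) ω :=
  Subtype.ext (SetLike.coe_injective (shift_shift s t _))

/-- The distance is jointly continuous, since it is Lipschitz in the point, uniformly in the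
closed set. -/
theorem continuous_infDist_prod {Ω : Set (ClosedSubset d)} (hΩ : IsDDS Ω) :
    Continuous fun p : E d × Ω => Metric.infDist p.1 (p.2.1 : Set (E d)) :=
  continuous_prod_of_continuous_lipschitzWith _ 1 (fun x => continuous_infDist hΩ x)
    fun ω => Metric.lipschitz_infDist_pt (ω.1 : Set (E d))

theorem IsDDS.continuous_map {Ω : Set (ClosedSubset d)} (hΩ : IsDDS Ω) :
    Continuous fun p : E d × Ω => hΩ.map p.1 p.2 := by
  have h' : ∀ q : E d, Continuous fun p : E d × Ω =>
      Metric.infDist q ((hΩ.map p.1 p.2).1 : Set (E d)) := by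
    intro q
    simp only [hΩ.infDist_map]
    have hc : Continuous fun p : E d × Ω => (q - p.1, p.2) :=
      (continuous_const.sub continuous_fst).prodMk continuous_snd
    have h3 := Continuous.comp (continuous_infDist_prod hΩ) hc
    exact h3
  refine (isClosedEmbedding_distSeq hΩ).isEmbedding.continuous_iff.2 ?_
  refine continuous_pi fun n => ?_
  exact h' (TopologicalSpace.denseSeq (E d) n)

/-! ### Boundaries of bounded sets and van Hove sequences -/

/-- A segment leaving `Q` meets the boundary of `Q`. -/
theorem mem_thickening_frontier_of_dist_lt {Q : Set (E d)} {x y : E d} {s : ℝ} (hx : x ∈ Q)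
    (hy : y ∉ Q) (h : dist x y < s) :
    x ∈ Metric.thickening s (frontier Q) ∧ y ∈ Metric.thickening s (frontier Q) := by
  obtain ⟨z, hz, hzQ⟩ : ∃ z ∈ segment ℝ x y, z ∈ frontier Q := by
    by_contra! hno
    have hxi : x ∈ interior Q := by
      by_contra h'
      exact hno x (left_mem_segment ℝ x y) ⟨subset_closure hx, h'⟩
    have hyc : y ∉ closure Q := fun h' =>
      hno y (right_mem_segment ℝ x y) ⟨h', fun h'' => hy (interior_subset h'')⟩
    obtain ⟨w, -, hwi, hwc⟩ := (convex_segment x y).isPreconnected (interior Q) (closure Q)ᶜ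
      isOpen_interior isClosed_closure.isOpen_compl
      (fun w hw => or_iff_not_imp_right.2 fun h' => by
        by_contra h''
        exact hno w hw ⟨not_not.1 h', h''⟩)
      ⟨x, left_mem_segment ℝ x y, hxi⟩ ⟨y, right_mem_segment ℝ x y, hyc⟩
    exact hwc (subset_closure (interior_subset hwi))
  have hxz := dist_add_dist_of_mem_segment hz
  have h1 : 0 ≤ dist x z := dist_nonneg
  have h2 : 0 ≤ dist z y := dist_nonneg
  refine ⟨Metric.mem_thickening_iff.2 ⟨z, hzQ, by linarith⟩,
    Metric.mem_thickening_iff.2 ⟨z, hzQ, ?_⟩⟩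
  rw [dist_comm]
  linarith

theorem isBounded_thickening_frontier {Q : Set (E d)} (hQ : Bornology.IsBounded Q) (s : ℝ) :
    Bornology.IsBounded (Metric.thickening s (frontier Q)) :=
  (hQ.closure.subset frontier_subset_closure).thickening

theorem volume_ne_top {A : Set (E d)} (hA : Bornology.IsBounded A) : volume A ≠ ⊤ :=
  hA.measure_lt_top.ne

/-- The volume of the `s`-boundary of `Q` relative to that of `Q`, as a real number. -/
def boundaryRatio (Q : Set (E d)) (s : ℝ) : ℝ :=
  (volume Q).toReal⁻¹ * (volume (Metric.thickening s (frontier Q))).toReal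

theorem IsVanHove.toReal_pos {Q : ℕ → Set (E d)} (hQ : IsVanHove Q) (n : ℕ) :
    0 < (volume (Q n)).toReal :=
  ENNReal.toReal_pos (hQ.volume_pos n).ne' (volume_ne_top (hQ.isBounded n))

theorem IsVanHove.tendsto_boundaryRatio {Q : ℕ → Set (E d)} (hQ : IsVanHove Q) {s : ℝ}
    (hs : 0 < s) : Tendsto (fun n => boundaryRatio (Q n) s) atTop (𝓝 0) := by
  have := (ENNReal.tendsto_toReal ENNReal.zero_ne_top).comp (hQ.tendsto s hs)
  simpa [Function.comp_def, boundaryRatio, ENNReal.toReal_div, div_eq_inv_mul] using this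

/-- Balls with radii tending to infinity form a van Hove sequence. -/
theorem isVanHove_closedBall :
    IsVanHove fun n : ℕ => Metric.closedBall (0 : E d) (n + 1) where
  isBounded _ := Metric.isBounded_closedBall
  measurableSet _ := Metric.isClosed_closedBall.measurableSet
  volume_pos n := Metric.measure_closedBall_pos _ _ (by positivity)
  tendsto s hs := by
    have hB0 : volume (Metric.ball (0 : E d) 1) ≠ 0 :=
      (Metric.measure_ball_pos _ _ one_pos).ne'
    have hBt : volume (Metric.ball (0 : E d) 1) ≠ ⊤ := volume_ne_top Metric.isBounded_ball
    -- the ratio is bounded by `((n + 1 + s) ^ d - (n + 1 - s) ^ d) / (n + 1) ^ d`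
    have hlim : Tendsto (fun n : ℕ => ENNReal.ofReal
        ((1 + s / ((n : ℝ) + 1)) ^ d - (1 - s / ((n : ℝ) + 1)) ^ d)) atTop (𝓝 0) := by
      have h0 : Tendsto (fun n : ℕ => s / ((n : ℝ) + 1)) atTop (𝓝 0) :=
        tendsto_const_nhds.div_atTop (tendsto_natCast_atTop_atTop.atTop_add tendsto_const_nhds)
      have h1 := ((h0.const_add 1).pow d).sub ((h0.const_sub 1).pow d)
      have h2 := ENNReal.tendsto_ofReal h1
      simpa using h2
    refine tendsto_of_tendsto_of_tendsto_of_le_of_le' tendsto_const_nhds hlim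
      (Eventually.of_forall fun _ => zero_le) ?_
    obtain ⟨N, hN⟩ := exists_nat_ge s
    filter_upwards [eventually_ge_atTop N] with n hn
    have hns : s ≤ n := hN.trans (by exact_mod_cast hn)
    have hn1 : (0 : ℝ) < (n : ℝ) + 1 := by positivity
    have hsub : Metric.thickening s (frontier (Metric.closedBall (0 : E d) (n + 1))) ⊆
        Metric.closedBall 0 (n + 1 + s) \ Metric.ball 0 (n + 1 - s) := by
      intro x hx
      obtain ⟨z, hz, hxz⟩ := Metric.mem_thickening_iff.1 hx
      have hz' : ‖z‖ = n + 1 := by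
        have := Metric.frontier_closedBall_subset_sphere hz
        simpa using this
      rw [dist_eq_norm] at hxz
      have h1 := norm_le_norm_add_norm_sub' x z
      have h2 := norm_le_norm_add_norm_sub x z
      refine ⟨?_, ?_⟩
      · rw [mem_closedBall_zero_iff]; linarith
      · rw [mem_ball_zero_iff]; linarith
    have hvol : volume (Metric.thickening s (frontier (Metric.closedBall (0 : E d) (n + 1)))) ≤
        ENNReal.ofReal ((n + 1 + s) ^ d - (n + 1 - s) ^ d) * volume (Metric.ball (0 : E d) 1) := by
      refine (measure_mono hsub).trans ?_
      rw [measure_sdiff (Metric.ball_subset_closedBall.trans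
        (Metric.closedBall_subset_closedBall (by linarith)))
        Metric.isOpen_ball.nullMeasurableSet (volume_ne_top Metric.isBounded_ball),
        Measure.addHaar_closedBall _ _ (by linarith),
        Measure.addHaar_ball_of_pos _ _ (show 0 < (n : ℝ) + 1 - s by linarith),
        finrank_euclideanSpace_fin, ENNReal.ofReal_sub _ (by apply pow_nonneg; linarith),
        ENNReal.sub_mul fun _ _ => hBt]
    refine (ENNReal.div_le_div_right hvol _).trans ?_
    rw [Measure.addHaar_closedBall _ _ hn1.le, finrank_euclideanSpace_fin,
      ENNReal.mul_div_mul_right _ _ hB0 hBt, ← ENNReal.ofReal_div_of_pos (by positivity)]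
    refine ENNReal.ofReal_le_ofReal (le_of_eq ?_)
    rw [sub_div, ← div_pow, ← div_pow, add_div, sub_div, div_self hn1.ne']

/-! ### Averages over bounded sets -/

/-- The average of `g` over the translates of `ω` by the elements of `-Q`. The sign is chosen so
that `t ∈ Q` stands for what is seen from the point `t`. -/
def average {Ω : Set (ClosedSubset d)} (hΩ : IsDDS Ω) (Q : Set (E d)) (g : Ω → ℝ) (ω : Ω) : ℝ :=
  (volume Q).toReal⁻¹ * ∫ t in Q, g (hΩ.map (-t) ω)

variable {Ω : Set (ClosedSubset d)}

theorem IsDDS.continuous_map_neg (hΩ : IsDDS Ω) (ω : Ω) :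
    Continuous fun t : E d => hΩ.map (-t) ω := by
  have hc : Continuous fun t : E d => (-t, ω) := continuous_neg.prodMk continuous_const
  have h3 := hΩ.continuous_map.comp hc
  exact h3

theorem IsDDS.continuous_map_const (hΩ : IsDDS Ω) (t : E d) : Continuous (hΩ.map t) := by
  have hc : Continuous fun ω : Ω => (t, ω) := continuous_const.prodMk continuous_id
  have h3 := hΩ.continuous_map.comp hc
  exact h3

theorem integrableOn_orbit (hΩ : IsDDS Ω) {Q : Set (E d)} (hQ : Bornology.IsBounded Q)
    (g : C(Ω, ℝ)) (ω : Ω) : IntegrableOn (fun t => g (hΩ.map (-t) ω)) Q := by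
  have := hΩ.compactSpace
  refine Measure.integrableOn_of_bounded (M := ‖g‖) (volume_ne_top hQ)
    (g.continuous.comp (hΩ.continuous_map_neg ω)).aestronglyMeasurable
    (Eventually.of_forall fun t => g.norm_coe_le_norm _)

theorem average_add (hΩ : IsDDS Ω) {Q : Set (E d)} (hQ : Bornology.IsBounded Q)
    (f g : C(Ω, ℝ)) (ω : Ω) :
    average hΩ Q (f + g) ω = average hΩ Q f ω + average hΩ Q g ω := by
  simp only [average, Pi.add_apply]
  rw [integral_add (integrableOn_orbit hΩ hQ f ω) (integrableOn_orbit hΩ hQ g ω), mul_add]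

theorem average_smul (hΩ : IsDDS Ω) (Q : Set (E d)) (c : ℝ) (g : Ω → ℝ) (ω : Ω) :
    average hΩ Q (c • g) ω = c * average hΩ Q g ω := by
  simp only [average, Pi.smul_apply, smul_eq_mul, integral_const_mul]
  ring

theorem average_nonneg (hΩ : IsDDS Ω) (Q : Set (E d)) {g : Ω → ℝ} (hg : 0 ≤ g) (ω : Ω) :
    0 ≤ average hΩ Q g ω :=
  mul_nonneg (by positivity) (integral_nonneg fun _ => hg _)

theorem average_const (hΩ : IsDDS Ω) {Q : Set (E d)} (hQ : 0 < (volume Q).toReal) (c : ℝ) (ω : Ω) :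
    average hΩ Q (fun _ => c) ω = c := by
  simp only [average, setIntegral_const, smul_eq_mul, measureReal_def]
  field_simp

theorem abs_average_le [CompactSpace Ω] (hΩ : IsDDS Ω) {Q : Set (E d)}
    (hQ : Bornology.IsBounded Q) (hQ0 : 0 < (volume Q).toReal) (g : C(Ω, ℝ)) (ω : Ω) :
    |average hΩ Q g ω| ≤ ‖g‖ := by
  have h := norm_setIntegral_le_of_norm_le_const (μ := volume) (s := Q)
    (f := fun t => g (hΩ.map (-t) ω)) (volume_ne_top hQ).lt_top
    (fun t _ => g.norm_coe_le_norm (hΩ.map (-t) ω))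
  rw [average, abs_mul, abs_of_pos (inv_pos.2 hQ0)]
  rw [measureReal_def, Real.norm_eq_abs] at h
  calc _ ≤ (volume Q).toReal⁻¹ * (‖g‖ * (volume Q).toReal) := by gcongr
    _ = ‖g‖ := by field_simp

/-- Averages over large sets are almost invariant under translations. -/
theorem abs_average_map_sub_le [CompactSpace Ω] (hΩ : IsDDS Ω) {Q : Set (E d)}
    (hQ : Bornology.IsBounded Q) (hQm : MeasurableSet Q) (g : C(Ω, ℝ)) (t : E d) (ω : Ω) :
    |average hΩ Q (fun ω' => g (hΩ.map t ω')) ω - average hΩ Q g ω| ≤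
      2 * ‖g‖ * boundaryRatio Q (‖t‖ + 1) := by
  set F : E d → ℝ := fun s => g (hΩ.map (-s) ω) with hF
  set D := Metric.thickening (‖t‖ + 1) (frontier Q)
  have hFc : Continuous F := g.continuous.comp (hΩ.continuous_map_neg ω)
  have hFint : ∀ A : Set (E d), Bornology.IsBounded A → IntegrableOn F A :=
    fun A hA => integrableOn_orbit hΩ hA g ω
  have hshift : ∀ s, g (hΩ.map t (hΩ.map (-s) ω)) = F (s - t) := by
    intro s
    simp only [hF, hΩ.map_add]
    congr 2
    abel
  have hdQ : Bornology.IsBounded D := isBounded_thickening_frontier hQ _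
  have hdQm : MeasurableSet D := Metric.isOpen_thickening.measurableSet
  have hFle : ∀ s, ‖F s‖ ≤ ‖g‖ := fun s => g.norm_coe_le_norm _
  have hkey : |(∫ s in Q, F (s - t)) - ∫ s in Q, F s| ≤ 2 * ‖g‖ * (volume D).toReal := by
    rw [← integral_indicator hQm, ← integral_indicator hQm,
      ← integral_add_right_eq_self (fun s => Q.indicator (fun s => F (s - t)) s) t]
    have hi2 : Integrable (Q.indicator F) := (integrable_indicator_iff hQm).2 (hFint Q hQ)
    have hi1 : Integrable fun s => Q.indicator (fun s => F (s - t)) (s + t) := by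
      have : Integrable (Q.indicator fun s => F (s - t)) := by
        refine (integrable_indicator_iff hQm).2 (Measure.integrableOn_of_bounded (M := ‖g‖)
          (volume_ne_top hQ) ?_ (Eventually.of_forall fun s => hFle _))
        exact (hFc.comp (continuous_id.sub continuous_const)).aestronglyMeasurable
      exact this.comp_add_right t
    rw [← integral_sub hi1 hi2]
    -- the integrands differ only where exactly one of `s + t` and `s` lies in `Q`
    have hbd : ∀ s, ‖Q.indicator (fun s => F (s - t)) (s + t) - Q.indicator F s‖ ≤
        D.indicator (fun _ => ‖g‖) s := by
      intro s
      by_cases h1 : s + t ∈ Q <;> by_cases h2 : s ∈ Q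
      · simp [h1, h2, indicator_nonneg]
      · have := (mem_thickening_frontier_of_dist_lt (s := ‖t‖ + 1) h1 h2 (by simp)).2
        rw [indicator_of_mem h1, indicator_of_notMem h2, indicator_of_mem this]
        simpa using hFle s
      · have := (mem_thickening_frontier_of_dist_lt (s := ‖t‖ + 1) h2 h1 (by simp)).1
        rw [indicator_of_notMem h1, indicator_of_mem h2, indicator_of_mem this]
        simpa using hFle s
      · simp [h1, h2, indicator_nonneg]
    have hb := norm_integral_le_of_norm_le
      ((integrable_indicator_iff hdQm).2 (integrableOn_const (C := ‖g‖) (volume_ne_top hdQ)))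
      (Eventually.of_forall hbd)
    rw [integral_indicator hdQm, setIntegral_const, measureReal_def, smul_eq_mul] at hb
    rw [Real.norm_eq_abs] at hb
    have : 0 ≤ ‖g‖ * (volume D).toReal := by positivity
    linarith
  simp only [average, hshift]
  rw [← mul_sub, abs_mul, abs_of_nonneg (by positivity), boundaryRatio]
  calc _ ≤ (volume Q).toReal⁻¹ * (2 * ‖g‖ * (volume D).toReal) := by gcongr
    _ = _ := by ring

/-- An invariant probability measure integrates a function and its averages alike. -/
theorem integral_average (hΩ : IsDDS Ω) {Q : Set (E d)} (hQ : Bornology.IsBounded Q)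
    (hQ0 : 0 < (volume Q).toReal) (μ : Measure Ω) [IsProbabilityMeasure μ]
    (hμ : ∀ t : E d, MeasurePreserving (hΩ.map t) μ μ) (g : C(Ω, ℝ)) :
    ∫ ω, average hΩ Q g ω ∂μ = ∫ ω, g ω ∂μ := by
  have := hΩ.compactSpace
  have := hΩ.metrizableSpace
  have := hΩ.secondCountableTopology
  have : IsFiniteMeasure (volume.restrict Q) := ⟨by simpa using (volume_ne_top hQ).lt_top⟩
  have hcont : Continuous fun p : Ω × E d => g (hΩ.map (-p.2) p.1) := by
    have hc : Continuous fun p : Ω × E d => (-p.2, p.1) :=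
      continuous_snd.neg.prodMk continuous_fst
    have h3 := g.continuous.comp (hΩ.continuous_map.comp hc)
    exact h3
  have hint : Integrable (Function.uncurry fun (ω : Ω) (t : E d) => g (hΩ.map (-t) ω))
      (μ.prod (volume.restrict Q)) :=
    Integrable.of_bound hcont.aestronglyMeasurable ‖g‖
      (Eventually.of_forall fun p => g.norm_coe_le_norm _)
  have hinv : ∀ t : E d, ∫ ω, g (hΩ.map (-t) ω) ∂μ = ∫ ω, g ω ∂μ := by
    intro t
    have h := integral_map (μ := μ) (hμ (-t)).measurable.aemeasurable
      (f := g) g.continuous.aestronglyMeasurable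
    rw [(hμ (-t)).map_eq] at h
    exact h.symm
  simp only [average, integral_const_mul]
  rw [integral_integral_swap hint]
  simp only [hinv, setIntegral_const, smul_eq_mul, measureReal_def]
  field_simp

/-! ### Invariant measures as limits of averages -/

/-- The invariant Borel probability measures on `Ω`. -/
def IsInvariantProbability (hΩ : IsDDS Ω) (μ : Measure Ω) : Prop :=
  IsProbabilityMeasure μ ∧ ∀ t : E d, MeasurePreserving (hΩ.map t) μ μ

/-- A finite measure on `Ω` is determined by the integrals of the continuous functions. -/
theorem measure_ext_of_integral_eq (hΩ : IsDDS Ω) {μ ν : Measure Ω} [IsFiniteMeasure μ]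
    [IsFiniteMeasure ν] (h : ∀ g : C(Ω, ℝ), ∫ ω, g ω ∂μ = ∫ ω, g ω ∂ν) : μ = ν := by
  have := hΩ.compactSpace
  have := hΩ.metrizableSpace
  let := TopologicalSpace.metrizableSpaceMetric Ω
  exact ext_of_forall_integral_eq_of_IsFiniteMeasure fun f => h f.toContinuousMap

/-- Limits, along an ultrafilter, of averages over a van Hove sequence are the integrals of an
invariant probability measure. -/
theorem exists_invariant_tendsto_average (hΩ : IsDDS Ω) {Q : ℕ → Set (E d)} (hQ : IsVanHove Q)
    (ω : ℕ → Ω) (𝒰 : Ultrafilter ℕ) (h𝒰 : (𝒰 : Filter ℕ) ≤ atTop) :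
    ∃ μ : Measure Ω, IsInvariantProbability hΩ μ ∧ ∀ g : C(Ω, ℝ),
      Tendsto (fun n => average hΩ (Q n) g (ω n)) 𝒰 (𝓝 (∫ ω, g ω ∂μ)) := by
  have := hΩ.compactSpace
  have := hΩ.metrizableSpace
  have hlim : ∀ g : C(Ω, ℝ), ∃ c : ℝ, Tendsto (fun n => average hΩ (Q n) g (ω n)) 𝒰 (𝓝 c) := by
    intro g
    have hle : ((𝒰.map fun n => average hΩ (Q n) g (ω n)) : Filter ℝ) ≤ 𝓟 (Icc (-‖g‖) ‖g‖) :=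
      le_principal_iff.2 (Filter.mem_map.2 <| Eventually.of_forall fun n =>
        abs_le.1 (abs_average_le hΩ (hQ.isBounded n) (hQ.toReal_pos n) g (ω n)))
    obtain ⟨c, -, hc⟩ := isCompact_Icc.ultrafilter_le_nhds _ hle
    exact ⟨c, hc⟩
  choose L hL using hlim
  have hLadd : ∀ f g, L (f + g) = L f + L g := fun f g =>
    tendsto_nhds_unique (hL (f + g)) (((hL f).add (hL g)).congr fun n =>
      (average_add hΩ (hQ.isBounded n) f g (ω n)).symm)
  have hLsmul : ∀ (c : ℝ) (g), L (c • g) = c * L g := fun c g =>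
    tendsto_nhds_unique (hL (c • g)) (((hL g).const_mul c).congr fun n =>
      (average_smul hΩ (Q n) c g (ω n)).symm)
  have hLnonneg : ∀ g : C(Ω, ℝ), 0 ≤ g → 0 ≤ L g := fun g hg =>
    ge_of_tendsto' (hL g) fun n => average_nonneg hΩ (Q n) (fun ω => hg ω) (ω n)
  have hLone : L (ContinuousMap.const Ω 1) = 1 :=
    tendsto_nhds_unique (hL _) (tendsto_const_nhds.congr fun n =>
      (average_const hΩ (hQ.toReal_pos n) 1 (ω n)).symm)
  let toC : CompactlySupportedContinuousMap Ω ℝ → C(Ω, ℝ) := fun f => f.toContinuousMap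
  let Λ : CompactlySupportedContinuousMap Ω ℝ →ₚ[ℝ] ℝ := PositiveLinearMap.mk₀
    { toFun := fun f => L (toC f)
      map_add' := fun f g => hLadd (toC f) (toC g)
      map_smul' := fun c f => hLsmul c (toC f) } fun f hf => hLnonneg (toC f) hf
  set μ := RealRMK.rieszMeasure Λ with hμ
  have hint : ∀ g : C(Ω, ℝ), ∫ ω, g ω ∂μ = L g := fun g =>
    RealRMK.integral_rieszMeasure Λ (CompactlySupportedContinuousMap.continuousMapEquiv g)
  have hprob : IsProbabilityMeasure μ := by
    have h1 := hint (ContinuousMap.const Ω 1)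
    rw [hLone] at h1
    simp only [ContinuousMap.const_apply, integral_const, smul_eq_mul, mul_one] at h1
    refine ⟨?_⟩
    rwa [measureReal_def, ENNReal.toReal_eq_one_iff] at h1
  refine ⟨μ, ⟨hprob, fun t => ⟨(hΩ.continuous_map_const t).measurable, ?_⟩⟩, fun g => ?_⟩
  · have hmeas := (hΩ.continuous_map_const t).measurable
    have : IsProbabilityMeasure (μ.map (hΩ.map t)) :=
      Measure.isProbabilityMeasure_map hmeas.aemeasurable
    refine measure_ext_of_integral_eq hΩ fun g => ?_
    rw [integral_map hmeas.aemeasurable g.continuous.aestronglyMeasurable, hint g]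
    have h1 := hint (g.comp ⟨hΩ.map t, hΩ.continuous_map_const t⟩)
    simp only [ContinuousMap.comp_apply, ContinuousMap.coe_mk] at h1
    rw [h1]
    refine tendsto_nhds_unique (hL _) ?_
    have hz : Tendsto (fun n => 2 * ‖g‖ * boundaryRatio (Q n) (‖t‖ + 1)) 𝒰 (𝓝 0) := by
      simpa using ((hQ.tendsto_boundaryRatio (s := ‖t‖ + 1) (by positivity)).mono_left
        h𝒰).const_mul (2 * ‖g‖)
    have hdiff := squeeze_zero_norm (f := fun n =>
      average hΩ (Q n) (fun ω' => g (hΩ.map t ω')) (ω n) - average hΩ (Q n) g (ω n))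
      (fun n => abs_average_map_sub_le hΩ (hQ.isBounded n)
      (hQ.measurableSet n) g t (ω n)) hz
    simpa [Function.comp_def] using hdiff.add (hL g)
  · rw [hint g]
    exact hL g

theorem exists_invariant (hΩ : IsDDS Ω) (hne : Ω.Nonempty) :
    ∃ μ : Measure Ω, IsInvariantProbability hΩ μ := by
  obtain ⟨μ, hμ, -⟩ := exists_invariant_tendsto_average hΩ isVanHove_closedBall
    (fun _ => ⟨hne.some, hne.some_mem⟩) (Ultrafilter.of atTop) (Ultrafilter.of_le _)
  exact ⟨μ, hμ⟩

/-- Under unique ergodicity the averages of a continuous function converge uniformly. Otherwise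
bad elements of `Ω` would give, in the limit, a second invariant measure. -/
theorem tendstoUniformly_average_of_uniquelyErgodic (hΩ : IsDDS Ω) (h : hΩ.UniquelyErgodic)
    {Q : ℕ → Set (E d)} (hQ : IsVanHove Q) (g : C(Ω, ℝ)) :
    ∃ c : ℝ, TendstoUniformly (fun n ω => average hΩ (Q n) g ω) (fun _ => c) atTop := by
  obtain ⟨μ, hμ, huniq⟩ := h
  refine ⟨∫ ω, g ω ∂μ, ?_⟩
  by_contra hcon
  rw [Metric.tendstoUniformly_iff] at hcon
  push Not at hcon
  obtain ⟨ε, hε, hfreq⟩ := hcon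
  have hne : (atTop ⊓ 𝓟 {n | ∃ ω, ε ≤ dist (∫ ω, g ω ∂μ) (average hΩ (Q n) g ω)}).NeBot :=
    frequently_mem_iff_neBot.1 hfreq
  set 𝒰 := Ultrafilter.of (atTop ⊓ 𝓟 {n | ∃ ω, ε ≤ dist (∫ ω, g ω ∂μ) (average hΩ (Q n) g ω)})
  have h𝒰 := Ultrafilter.of_le
    (atTop ⊓ 𝓟 {n | ∃ ω, ε ≤ dist (∫ ω, g ω ∂μ) (average hΩ (Q n) g ω)})
  have hΩne : Nonempty Ω := by
    obtain ⟨n, ω, -⟩ := hfreq.exists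
    exact ⟨ω⟩
  have hsel : ∀ n, ∃ ω : Ω, (∃ ω, ε ≤ dist (∫ ω, g ω ∂μ) (average hΩ (Q n) g ω)) →
      ε ≤ dist (∫ ω, g ω ∂μ) (average hΩ (Q n) g ω) := by
    intro n
    by_cases hn : ∃ ω, ε ≤ dist (∫ ω, g ω ∂μ) (average hΩ (Q n) g ω)
    · exact ⟨hn.choose, fun _ => hn.choose_spec⟩
    · exact ⟨hΩne.some, fun h' => absurd h' hn⟩
  choose ω hω using hsel
  obtain ⟨ν, hν, hνlim⟩ := exists_invariant_tendsto_average hΩ hQ ω 𝒰 (h𝒰.trans inf_le_left)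
  have hbad : ∀ᶠ n in (𝒰 : Filter ℕ), ε ≤ dist (∫ ω, g ω ∂μ) (average hΩ (Q n) g (ω n)) :=
    mem_of_superset (le_principal_iff.1 (h𝒰.trans inf_le_right)) fun n hn => hω n hn
  have hgood := hνlim g
  rw [huniq ν hν, Metric.tendsto_nhds] at hgood
  obtain ⟨n, hn1, hn2⟩ := (hbad.and (hgood ε hε)).exists
  rw [dist_comm] at hn2
  exact absurd hn2 (not_lt.2 hn1)

/-! ### Finite local complexity -/

/-- A difference of norm at most `s` is visible in a ball pattern of radius `s`, and there are only
finitely many of these up to translation. -/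
theorem IsDDSF.finite_differences (hΩ : IsDDSF Ω) (s : ℝ) :
    {z : E d | ‖z‖ ≤ s ∧ ∃ ω ∈ Ω, ∃ x ∈ ω, x + z ∈ ω}.Finite := by
  -- the finite type condition only speaks of positive radii
  set s' := max s 1 with hs'
  have hs'0 : 0 < s' := lt_max_of_lt_right one_pos
  refine ((hΩ.finite_type s' hs'0).biUnion (t := fun P => image2 (fun a b => b - a)
    (Quotient.out P).points (Quotient.out P).points) fun P _ =>
      (Quotient.out P).finite.image2 _ (Quotient.out P).finite).subset ?_
  rintro z ⟨hz, ω, hω, x, hx, hxz⟩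
  obtain ⟨t, ht, -⟩ : (wedge (ω : Set (E d)) (hΩ.isDelone ω hω) (Metric.closedBall x s')
      Metric.isBounded_closedBall).out ≈ _ := Quotient.exact (Quotient.out_eq _)
  refine mem_biUnion (mem_iUnion.2 ⟨⟨ω, hω⟩, x, hx, rfl⟩) ⟨x + t, ?_, x + z + t, ?_,
    show x + z + t - (x + t) = z by abel⟩
  · rw [ht]
    exact ⟨x, ⟨hx, Metric.mem_closedBall_self hs'0.le⟩, rfl⟩
  · rw [ht]
    exact ⟨x + z, ⟨hxz, by simpa [hs'] using Or.inl hz⟩, rfl⟩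

/-- A uniform lower bound for the distances within the elements of `Ω`. -/
theorem IsDDSF.exists_separation (hΩ : IsDDSF Ω) :
    ∃ r : ℝ, 0 < r ∧ ∀ ω ∈ Ω, ∀ x ∈ ω, ∀ y ∈ ω, x ≠ y → r ≤ ‖x - y‖ := by
  have hfin := hΩ.finite_differences 1
  have hmin : ∃ δ : ℝ, 0 < δ ∧
      ∀ z ∈ {z : E d | ‖z‖ ≤ 1 ∧ ∃ ω ∈ Ω, ∃ x ∈ ω, x + z ∈ ω}, z ≠ 0 → δ ≤ ‖z‖ := by
    obtain ⟨δ, hδ, hball⟩ := Metric.isOpen_iff.1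
      (hfin.subset (sdiff_subset (t := {0}))).isClosed.isOpen_compl 0 (by simp)
    refine ⟨δ, hδ, fun z hz hz0 => ?_⟩
    by_contra! hlt
    exact hball (mem_ball_zero_iff.2 hlt) ⟨hz, hz0⟩
  obtain ⟨δ, hδ, hmin⟩ := hmin
  refine ⟨min δ 1, lt_min hδ one_pos, fun ω hω x hx y hy hxy => ?_⟩
  by_cases h1 : ‖x - y‖ ≤ 1
  · exact (min_le_left _ _).trans
      (hmin _ ⟨h1, ω, hω, y, hy, by simpa using hx⟩ (sub_ne_zero.2 hxy))
  · exact (min_le_right _ _).trans (not_le.1 h1).le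

/-! ### Counting points of a separated set -/

/-- Volume bound for the number of points of an `r`-separated set. -/
theorem card_mul_volume_ball_le {r : ℝ} {S : Finset (E d)} {A : Set (E d)}
    (hS : ∀ x ∈ S, ∀ y ∈ S, x ≠ y → r ≤ ‖x - y‖) (hSA : ∀ x ∈ S, x ∈ A)
    (hA : Bornology.IsBounded A) :
    (S.card : ℝ) * (volume (Metric.ball (0 : E d) (r / 2))).toReal ≤
      (volume (Metric.thickening (r / 2) A)).toReal := by
  have hdisj : (S : Set (E d)).PairwiseDisjoint fun x => Metric.ball x (r / 2) := by
    intro x hx y hy hxy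
    refine Metric.ball_disjoint_ball ?_
    rw [dist_eq_norm]
    linarith [hS x hx y hy hxy]
  have hvol := measure_biUnion_finset (μ := volume) hdisj fun x _ =>
    Metric.isOpen_ball.measurableSet
  have hsub : (⋃ x ∈ S, Metric.ball x (r / 2)) ⊆ Metric.thickening (r / 2) A := by
    refine iUnion₂_subset fun x hx => ?_
    exact Metric.ball_subset_thickening (hSA x hx) _
  have hle := measure_mono (μ := volume) hsub
  rw [hvol] at hle
  simp only [Measure.addHaar_ball_center, Finset.sum_const, nsmul_eq_mul] at hle
  have := ENNReal.toReal_mono (volume_ne_top hA.thickening) hle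
  simpa using this

/-- Comparison of the integral over `Q` of a sum of translates of `φ` with the number of
translates centred in `Q`: only the centres near the boundary of `Q` contribute to the error. -/
theorem abs_setIntegral_sum_sub_le {φ : E d → ℝ} (hφ : Integrable φ) {s : ℝ}
    (hφs : ∀ z, φ z ≠ 0 → ‖z‖ < s) {Q : Set (E d)} (hQm : MeasurableSet Q) (S : Finset (E d))
    [DecidablePred (· ∈ Q)] [DecidablePred (· ∈ Metric.thickening s (frontier Q))] :
    |(∫ t in Q, ∑ x ∈ S, φ (x - t)) - (∫ z, φ z) * (S.filter (· ∈ Q)).card| ≤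
      (∫ z, |φ z|) * (S.filter (· ∈ Metric.thickening s (frontier Q))).card := by
  have hint : ∀ x : E d, Integrable fun t => φ (x - t) := fun x => hφ.comp_sub_left x
  rw [integral_finsetSum _ fun x _ => (hint x).integrableOn, Finset.card_filter,
    Finset.card_filter]
  push_cast
  rw [Finset.mul_sum, Finset.mul_sum, ← Finset.sum_sub_distrib]
  refine (Finset.abs_sum_le_sum_abs _ _).trans (Finset.sum_le_sum fun x _ => ?_)
  have hφx : ∫ z, φ z = ∫ t, φ (x - t) := (integral_sub_left_eq_self φ volume x).symm
  have habs : ∫ z, |φ z| = ∫ t, |φ (x - t)| :=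
    (integral_sub_left_eq_self (fun z => |φ z|) volume x).symm
  rw [hφx, habs, ← integral_indicator hQm]
  have hdiff : (∫ t, Q.indicator (fun t => φ (x - t)) t) -
      (∫ t, φ (x - t)) * (if x ∈ Q then 1 else 0) =
      ∫ t, (Q.indicator (fun t => φ (x - t)) t - φ (x - t) * (if x ∈ Q then 1 else 0)) := by
    rw [integral_sub ((hint x).indicator hQm) ((hint x).mul_const _), integral_mul_const]
  rw [hdiff, ← integral_mul_const]
  rw [← Real.norm_eq_abs]
  refine norm_integral_le_of_norm_le ((hint x).abs.mul_const _) (Eventually.of_forall fun t => ?_)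
  rw [Real.norm_eq_abs]
  by_cases hz : φ (x - t) = 0
  · have : Q.indicator (fun t => φ (x - t)) t = 0 := by
      by_cases ht : t ∈ Q <;> simp [ht, hz]
    simp [this, hz]
  have hdist : dist x t < s := by
    rw [dist_eq_norm]
    exact hφs _ hz
  by_cases hx : x ∈ Q <;> by_cases ht : t ∈ Q
  · simp only [hx, ht, indicator_of_mem, if_true, mul_one, sub_self, abs_zero]
    positivity
  · simp [hx, ht, (mem_thickening_frontier_of_dist_lt hx ht hdist).1]
  · rw [dist_comm] at hdist
    simp [hx, ht, (mem_thickening_frontier_of_dist_lt ht hx hdist).2]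
  · simp only [hx, ht, not_false_eq_true, indicator_of_notMem, if_false, mul_zero, sub_self,
      abs_zero]
    positivity

/-- If `Y` is a pattern with `0` among its points, then the occurrences of `Y` in `ω ∧ Q` are, up
to an error near the boundary of `Q`, the points `x` of `ω` in `Q` where `ω` contains the points
of `Y + x`. -/
theorem abs_occurrences_sub_le {ω : Set (E d)} (hω : IsDelone ω) {Q : Set (E d)}
    (hQ : Bornology.IsBounded Q) (Y : Pattern d) (h0 : (0 : E d) ∈ Y.points) {s : ℝ}
    (hs : ∀ y ∈ Y.support, ‖y‖ < s) (S : Finset (E d))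
    (hS : ∀ x, x ∈ S ↔ x ∈ Q ∪ Metric.thickening s (frontier Q) ∧ shift x Y.points ⊆ ω)
    [DecidablePred (· ∈ Q)] [DecidablePred (· ∈ Metric.thickening s (frontier Q))] :
    |((S.filter (· ∈ Q)).card : ℝ) -
        PatternClass.occurrences (Quotient.mk (patternSetoid d) Y) (wedge ω hω Q hQ)| ≤
      (S.filter (· ∈ Metric.thickening s (frontier Q))).card := by
  set O : Set (E d) := {t | shift t Y.points ⊆ ω ∩ Q ∧ shift t Y.support ⊆ Q} with hO
  have hocc : PatternClass.occurrences (Quotient.mk (patternSetoid d) Y) (wedge ω hω Q hQ) =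
      O.ncard := rfl
  have hO1 : O ⊆ (S.filter (· ∈ Q) : Finset (E d)) := by
    intro t ht
    have htQ : t ∈ Q := (ht.1 ⟨0, h0, zero_add t⟩).2
    exact Finset.mem_coe.2 (Finset.mem_filter.2
      ⟨(hS t).2 ⟨Or.inl htQ, ht.1.trans inter_subset_left⟩, htQ⟩)
  have hO2 : ((S.filter (· ∈ Q) : Finset (E d)) : Set (E d)) ⊆
      O ∪ (S.filter (· ∈ Metric.thickening s (frontier Q)) : Finset (E d)) := by
    intro x hx
    obtain ⟨hxS, hxQ⟩ := Finset.mem_filter.1 (Finset.mem_coe.1 hx)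
    by_cases hxd : x ∈ Metric.thickening s (frontier Q)
    · exact Or.inr (Finset.mem_coe.2 (Finset.mem_filter.2 ⟨hxS, hxd⟩))
    · have hsup : shift x Y.support ⊆ Q := by
        rintro _ ⟨y, hy, rfl⟩
        by_contra hyQ
        exact hxd (mem_thickening_frontier_of_dist_lt hxQ hyQ (by simpa using hs y hy)).1
      refine Or.inl ⟨subset_inter ((hS x).1 hxS).2 ?_, hsup⟩
      exact (image_mono Y.subset).trans hsup
  have hfin : O.Finite := (Finset.finite_toSet _).subset hO1
  have h1 := Set.ncard_le_ncard hO1 (Finset.finite_toSet _)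
  have h2 := (Set.ncard_le_ncard hO2 (hfin.union (Finset.finite_toSet _))).trans
    (Set.ncard_union_le _ _)
  rw [Set.ncard_coe_finset] at h1
  rw [Set.ncard_coe_finset, Set.ncard_coe_finset] at h2
  rw [hocc, abs_le]
  have h1' : (O.ncard : ℝ) ≤ (S.filter (· ∈ Q)).card := by exact_mod_cast h1
  have h2' : ((S.filter (· ∈ Q)).card : ℝ) ≤
      O.ncard + (S.filter (· ∈ Metric.thickening s (frontier Q))).card := by exact_mod_cast h2
  constructor <;> linarith

/-- Averaging a sum of translates of `φ`, centred at the points where a pattern `Y` occurs,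
gives the frequency of `Y` times the integral of `φ`, up to a boundary term. -/
theorem abs_average_sum_sub_le {ω : Set (E d)} (hω : IsDelone ω) {r : ℝ} (hr : 0 < r)
    (hωr : ∀ x ∈ ω, ∀ y ∈ ω, x ≠ y → r ≤ ‖x - y‖) {Q : Set (E d)}
    (hQ : Bornology.IsBounded Q) (hQm : MeasurableSet Q) (Y : Pattern d)
    (h0 : (0 : E d) ∈ Y.points) {s : ℝ} (hs : ∀ y ∈ Y.support, ‖y‖ < s) {φ : E d → ℝ}
    (hφ : Integrable φ) (hφs : ∀ z, φ z ≠ 0 → ‖z‖ < s) (S : Finset (E d))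
    (hS : ∀ x, x ∈ S ↔ x ∈ Q ∪ Metric.thickening s (frontier Q) ∧ shift x Y.points ⊆ ω) :
    |(volume Q).toReal⁻¹ * (∫ t in Q, ∑ x ∈ S, φ (x - t)) - (∫ z, φ z) *
        ((volume Q).toReal⁻¹ *
          PatternClass.occurrences (Quotient.mk (patternSetoid d) Y) (wedge ω hω Q hQ))| ≤
      2 * (∫ z, |φ z|) * (volume (Metric.ball (0 : E d) (r / 2))).toReal⁻¹ *
        boundaryRatio Q (r / 2 + s) := by
  classical
  set V := (volume (Metric.ball (0 : E d) (r / 2))).toReal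
  have hV : 0 < V := ENNReal.toReal_pos (Metric.measure_ball_pos _ _ (half_pos hr)).ne'
    (volume_ne_top Metric.isBounded_ball)
  set I := ∫ t in Q, ∑ x ∈ S, φ (x - t)
  set N : ℝ := ((S.filter (· ∈ Q)).card : ℝ)
  set B : ℝ := ((S.filter (· ∈ Metric.thickening s (frontier Q))).card : ℝ)
  set O : ℝ := ((PatternClass.occurrences (Quotient.mk (patternSetoid d) Y)
    (wedge ω hω Q hQ) : ℕ) : ℝ)
  set W := (volume (Metric.thickening (r / 2 + s) (frontier Q))).toReal
  have h1 : |I - (∫ z, φ z) * N| ≤ (∫ z, |φ z|) * B := abs_setIntegral_sum_sub_le hφ hφs hQm S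
  have h2 : |N - O| ≤ B := abs_occurrences_sub_le hω hQ Y h0 hs S hS
  have h3 : B * V ≤ W := by
    have hSω : ∀ x ∈ S, x ∈ ω := fun x hx => ((hS x).1 hx).2 ⟨0, h0, zero_add x⟩
    refine (card_mul_volume_ball_le (A := Metric.thickening s (frontier Q))
      (fun x hx y hy => hωr x (hSω x (Finset.mem_filter.1 hx).1) y
        (hSω y (Finset.mem_filter.1 hy).1)) (fun x hx => (Finset.mem_filter.1 hx).2)
      (isBounded_thickening_frontier hQ s)).trans ?_
    exact ENNReal.toReal_mono (volume_ne_top (isBounded_thickening_frontier hQ _))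
      (measure_mono (Metric.thickening_thickening_subset _ _ _))
  have hK : |∫ z, φ z| ≤ ∫ z, |φ z| := abs_integral_le_integral_abs
  have hK0 : 0 ≤ ∫ z, |φ z| := (abs_nonneg _).trans hK
  have hB : B ≤ V⁻¹ * W := by
    rw [← div_eq_inv_mul, le_div_iff₀ hV]
    exact h3
  have hq : 0 ≤ (volume Q).toReal⁻¹ := by positivity
  have h4 : |I - (∫ z, φ z) * O| ≤ 2 * (∫ z, |φ z|) * (V⁻¹ * W) := by
    have e : I - (∫ z, φ z) * O = (I - (∫ z, φ z) * N) + (∫ z, φ z) * (N - O) := by ring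
    rw [e]
    refine (abs_add_le _ _).trans ?_
    rw [abs_mul]
    have h5 : |∫ z, φ z| * |N - O| ≤ (∫ z, |φ z|) * B := mul_le_mul hK h2 (abs_nonneg _) hK0
    nlinarith [mul_le_mul_of_nonneg_left hB hK0]
  have e : (volume Q).toReal⁻¹ * I - (∫ z, φ z) * ((volume Q).toReal⁻¹ * O) =
      (volume Q).toReal⁻¹ * (I - (∫ z, φ z) * O) := by ring
  rw [e, abs_mul, abs_of_nonneg hq]
  calc _ ≤ (volume Q).toReal⁻¹ * (2 * (∫ z, |φ z|) * (V⁻¹ * W)) := by gcongr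
    _ = _ := by rw [boundaryRatio]; ring

/-! ### Observables built from distances -/

/-- The profile of the bump functions: a cone of height and radius `η`. -/
def cone (η u : ℝ) : ℝ := max 0 (η - u)

theorem cone_nonneg (η u : ℝ) : 0 ≤ cone η u := le_max_left _ _

theorem cone_eq_zero {η u : ℝ} (h : η ≤ u) : cone η u = 0 := max_eq_left (by linarith)

theorem lt_of_cone_ne_zero {η u : ℝ} (h : cone η u ≠ 0) : u < η := by
  by_contra! h'
  exact h (cone_eq_zero h')

theorem continuous_cone (η : ℝ) : Continuous (cone η) :=
  continuous_const.max (continuous_const.sub continuous_id)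

/-- The observable `ω ↦ cone η (dist(q, ω))`. -/
def coneAt (hΩ : IsDDS Ω) (η : ℝ) (q : E d) : C(Ω, ℝ) :=
  ⟨fun ω => cone η (Metric.infDist q (ω.1 : Set (E d))),
    (continuous_cone η).comp (continuous_infDist hΩ q)⟩

/-- In a set with distances at least `2η`, at most one point contributes to the cone at `y`. -/
theorem cone_infDist_eq_sum {ω : Set (E d)} {η : ℝ}
    (hsep : ∀ x ∈ ω, ∀ y ∈ ω, x ≠ y → 2 * η ≤ ‖x - y‖) (hne : ω.Nonempty) (y : E d)
    (S : Finset (E d)) (hSω : ∀ x ∈ S, x ∈ ω) (hS : ∀ x ∈ ω, ‖y - x‖ < η → x ∈ S) :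
    cone η (Metric.infDist y ω) = ∑ x ∈ S, cone η ‖y - x‖ := by
  by_cases hex : ∃ x ∈ ω, ‖y - x‖ < η
  · obtain ⟨x, hx, hyx⟩ := hex
    have hfar : ∀ z ∈ ω, z ≠ x → η ≤ ‖y - z‖ := by
      intro z hz hzx
      have h1 := hsep z hz x hx hzx
      have h2 := norm_sub_le_norm_sub_add_norm_sub z y x
      rw [norm_sub_rev z y] at h2
      linarith
    rw [Finset.sum_eq_single_of_mem x (hS x hx hyx)
      fun z hz hzx => cone_eq_zero (hfar z (hSω z hz) hzx)]
    congr 1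
    refine le_antisymm ((Metric.infDist_le_dist_of_mem hx).trans_eq (dist_eq_norm _ _)) ?_
    refine (Metric.le_infDist hne).2 fun {z} hz => ?_
    rw [dist_eq_norm]
    by_cases hzx : z = x
    · rw [hzx]
    · exact hyx.le.trans (hfar z hz hzx)
  · push Not at hex
    rw [Finset.sum_eq_zero fun x hx => cone_eq_zero (hex x (hSω x hx))]
    refine cone_eq_zero ((Metric.le_infDist hne).2 fun {z} hz => ?_)
    rw [dist_eq_norm]
    exact hex z hz

variable {ι : Type*} [Fintype ι]

/-- The product of the cone observables at `q₀` and at the points `q i`. -/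
def coneProd (hΩ : IsDDS Ω) (η : ℝ) (q₀ : E d) (q : ι → E d) : C(Ω, ℝ) :=
  coneAt hΩ η q₀ * ∏ i, coneAt hΩ η (q i)

/-- The contribution to `coneProd` of a point at `z` accompanied by points at `z + v i`. -/
def coneProfile (η : ℝ) (q₀ : E d) (q v : ι → E d) (z : E d) : ℝ :=
  cone η ‖q₀ - z‖ * ∏ i, cone η ‖q i - (z + v i)‖

theorem coneProfile_nonneg (η : ℝ) (q₀ : E d) (q v : ι → E d) (z : E d) :
    0 ≤ coneProfile η q₀ q v z :=
  mul_nonneg (cone_nonneg _ _) (Finset.prod_nonneg fun _ _ => cone_nonneg _ _)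

theorem norm_sub_lt_of_coneProfile_ne_zero {η : ℝ} {q₀ : E d} {q v : ι → E d} {z : E d}
    (h : coneProfile η q₀ q v z ≠ 0) :
    ‖q₀ - z‖ < η ∧ ∀ i, ‖q i - (z + v i)‖ < η :=
  ⟨lt_of_cone_ne_zero (left_ne_zero_of_mul h), fun i =>
    lt_of_cone_ne_zero (Finset.prod_ne_zero_iff.1 (right_ne_zero_of_mul h) i (Finset.mem_univ i))⟩

theorem norm_lt_of_coneProfile_ne_zero {η : ℝ} {q₀ : E d} {q v : ι → E d} {z : E d}
    (h : coneProfile η q₀ q v z ≠ 0) : ‖z‖ < ‖q₀‖ + η := by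
  have h1 := (norm_sub_lt_of_coneProfile_ne_zero h).1
  linarith [norm_le_norm_add_norm_sub q₀ z]

theorem continuous_coneProfile (η : ℝ) (q₀ : E d) (q v : ι → E d) :
    Continuous (coneProfile η q₀ q v) := by
  refine ((continuous_cone η).comp (by fun_prop)).mul
    (continuous_finsetProd _ fun i _ => (continuous_cone η).comp (by fun_prop))

theorem hasCompactSupport_coneProfile (η : ℝ) (q₀ : E d) (q v : ι → E d) :
    HasCompactSupport (coneProfile η q₀ q v) := by
  refine HasCompactSupport.intro (isCompact_closedBall (0 : E d) (‖q₀‖ + η)) fun z hz => ?_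
  by_contra h
  exact hz (mem_closedBall_zero_iff.2 (norm_lt_of_coneProfile_ne_zero h).le)

theorem integrable_coneProfile (η : ℝ) (q₀ : E d) (q v : ι → E d) :
    Integrable (coneProfile η q₀ q v) :=
  (continuous_coneProfile η q₀ q v).integrable_of_hasCompactSupport
    (hasCompactSupport_coneProfile η q₀ q v)

/-- Along an orbit, `coneProd` is a sum of translates of profiles, centred at the points where
`ω` contains the configuration `{0} ∪ {v i}`. Only configurations `v` with values in a finite
set `D` of differences matter. -/
theorem coneProd_map_neg_eq_sum [DecidableEq ι] (hΩ : IsDDS Ω) {η ρ : ℝ} (ω : Ω)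
    (hsep : ∀ x ∈ ω.1, ∀ y ∈ ω.1, x ≠ y → 2 * η ≤ ‖x - y‖)
    (q₀ : E d) (q : ι → E d) (hρ : ∀ i, ‖q i - q₀‖ + 2 * η ≤ ρ) (D : Finset (E d))
    (hD : ∀ x ∈ ω.1, ∀ z : E d, x + z ∈ ω.1 → ‖z‖ ≤ ρ → z ∈ D) (t : E d) (S : Finset (E d))
    (hSω : ∀ x ∈ S, x ∈ ω.1) (hS : ∀ x ∈ ω.1, ‖x - t‖ < ‖q₀‖ + η → x ∈ S)
    [∀ v : ι → E d, DecidablePred fun x => ∀ i, x + v i ∈ ω.1] :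
    coneProd hΩ η q₀ q (hΩ.map (-t) ω) =
      ∑ v ∈ Fintype.piFinset fun _ : ι => D, ∑ x ∈ S.filter (fun x => ∀ i, x + v i ∈ ω.1),
        coneProfile η q₀ q v (x - t) := by
  classical
  have hne := (hΩ.isDelone ω.1 ω.2).nonempty
  simp only [coneProd, ContinuousMap.mul_apply, ContinuousMap.prod_apply, coneAt,
    ContinuousMap.coe_mk, hΩ.infDist_map, sub_neg_eq_add]
  rw [cone_infDist_eq_sum hsep hne (q₀ + t) S hSω fun x hx hlt => hS x hx (by
    have h1 := norm_sub_norm_le (x - t) q₀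
    rw [show x - t - q₀ = -(q₀ + t - x) by abel, norm_neg] at h1
    linarith), Finset.sum_mul]
  simp only [Finset.sum_filter]
  rw [Finset.sum_comm]
  refine Finset.sum_congr rfl fun x hx => ?_
  by_cases h0 : cone η ‖q₀ + t - x‖ = 0
  · rw [h0, zero_mul]
    refine (Finset.sum_eq_zero fun v _ => ?_).symm
    rw [show q₀ + t - x = q₀ - (x - t) by abel] at h0
    simp [coneProfile, h0]
  have hlt := lt_of_cone_ne_zero h0
  have hfac : ∀ i, cone η (Metric.infDist (q i + t) (ω.1 : Set (E d))) =
      ∑ z ∈ D, if x + z ∈ ω.1 then cone η ‖q i + t - (x + z)‖ else 0 := by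
    intro i
    rw [cone_infDist_eq_sum hsep hne (q i + t) ((D.filter fun z => x + z ∈ ω.1).image (x + ·))
      ?_ ?_, Finset.sum_image fun a _ b _ h => add_left_cancel h, Finset.sum_filter]
    · intro y hy
      obtain ⟨z, hz, rfl⟩ := Finset.mem_image.1 hy
      exact (Finset.mem_filter.1 hz).2
    · intro y hy hyq
      refine Finset.mem_image.2 ⟨y - x, Finset.mem_filter.2 ⟨?_, by simpa using hy⟩, by simp⟩
      refine hD x (hSω x hx) _ (by simpa using hy) (le_trans ?_ (hρ i))
      have e : y - x = (q i - q₀) + ((q₀ + t - x) - (q i + t - y)) := by abel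
      rw [e]
      refine (norm_add_le _ _).trans ?_
      have := norm_sub_le (q₀ + t - x) (q i + t - y)
      linarith
  simp only [hfac]
  rw [Finset.prod_univ_sum, Finset.mul_sum]
  refine Finset.sum_congr rfl fun v _ => ?_
  rw [Finset.prod_ite_zero]
  simp only [Finset.mem_univ, true_implies]
  by_cases hv : ∀ i, x + v i ∈ ω.1
  · rw [if_pos hv, if_pos hv, coneProfile]
    congr 1
    · congr 2; abel
    · refine Finset.prod_congr rfl fun i _ => ?_
      congr 2; abel
  · rw [if_neg hv, if_neg hv, mul_zero]

/-- The averages of `coneProd` are, up to a boundary term, linear combinations of the frequencies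
of finitely many patterns. The supports of the patterns do not matter. -/
theorem exists_abs_average_coneProd_sub_le [DecidableEq ι] (hΩ : IsDDSF Ω) {r η ρ : ℝ}
    (hr : 0 < r) (hsep : ∀ ω ∈ Ω, ∀ x ∈ ω, ∀ y ∈ ω, x ≠ y → r ≤ ‖x - y‖) (hη : 0 < η)
    (hηr : 2 * η ≤ r)
    (q₀ : E d) (q : ι → E d) (hρ : ∀ i, ‖q i - q₀‖ + 2 * η ≤ ρ) (D : Finset (E d))
    (hD : ∀ ω ∈ Ω, ∀ x ∈ ω, ∀ z : E d, x + z ∈ ω → ‖z‖ ≤ ρ → z ∈ D)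
    (Y : (ι → E d) → Pattern d) (hY : ∀ v, (Y v).points = insert 0 (range v)) :
    ∃ C s : ℝ, 0 < s ∧ ∀ (ω : Ω) (Q : Set (E d)) (hQ : Bornology.IsBounded Q), MeasurableSet Q →
      |average hΩ.toIsDDS Q (coneProd hΩ.toIsDDS η q₀ q) ω -
        ∑ v ∈ Fintype.piFinset fun _ : ι => D, (∫ z, coneProfile η q₀ q v z) *
          ((volume Q).toReal⁻¹ * PatternClass.occurrences (Quotient.mk (patternSetoid d) (Y v))
            (wedge (ω.1 : Set (E d)) (hΩ.isDelone ω.1 ω.2) Q hQ))| ≤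
      C * boundaryRatio Q s := by
  classical
  -- a common bound for the supports of all patterns and all profiles
  obtain ⟨s, hs1, hs2⟩ : ∃ s : ℝ, ‖q₀‖ + η ≤ s ∧
      ∀ v ∈ Fintype.piFinset fun _ : ι => D, ∀ y ∈ (Y v).support, ‖y‖ < s := by
    have hb : Bornology.IsBounded (⋃ v ∈ Fintype.piFinset fun _ : ι => D, (Y v).support) :=
      (Bornology.isBounded_biUnion_finset _).2 fun v _ => (Y v).isBounded
    obtain ⟨M, hM⟩ := hb.exists_norm_le
    refine ⟨max (‖q₀‖ + η) (M + 1), le_max_left _ _, fun v hv y hy => ?_⟩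
    have := hM y (mem_biUnion hv hy)
    exact lt_max_of_lt_right (by linarith)
  have hs0 : 0 < s := lt_of_lt_of_le (by positivity) hs1
  refine ⟨∑ v ∈ Fintype.piFinset fun _ : ι => D, 2 * (∫ z, |coneProfile η q₀ q v z|) *
    (volume (Metric.ball (0 : E d) (r / 2))).toReal⁻¹, r / 2 + s, by positivity,
    fun ω Q hQ hQm => ?_⟩
  have hK : Bornology.IsBounded (Q ∪ Metric.thickening s (frontier Q)) :=
    hQ.union (isBounded_thickening_frontier hQ s)
  set S := ((hΩ.isDelone ω.1 ω.2).finite_inter hK).toFinset with hSdef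
  have hSmem : ∀ x, x ∈ S ↔ x ∈ ω.1 ∧ x ∈ Q ∪ Metric.thickening s (frontier Q) := fun x => by
    simp [hSdef]
  have hpt : ∀ t ∈ Q, coneProd hΩ.toIsDDS η q₀ q (hΩ.toIsDDS.map (-t) ω) =
      ∑ v ∈ Fintype.piFinset fun _ : ι => D, ∑ x ∈ S.filter (fun x => ∀ i, x + v i ∈ ω.1),
        coneProfile η q₀ q v (x - t) := by
    intro t ht
    refine coneProd_map_neg_eq_sum hΩ.toIsDDS ω
      (fun x hx y hy hxy => hηr.trans (hsep ω.1 ω.2 x hx y hy hxy)) q₀ q hρ D (hD ω.1 ω.2) t S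
      (fun x hx => ((hSmem x).1 hx).1) fun x hx hxt => (hSmem x).2 ⟨hx, ?_⟩
    by_cases hxQ : x ∈ Q
    · exact Or.inl hxQ
    · refine Or.inr (mem_thickening_frontier_of_dist_lt ht hxQ ?_).2
      rw [dist_comm, dist_eq_norm]
      linarith
  have hint : ∀ (v : ι → E d) (x : E d), Integrable fun t => coneProfile η q₀ q v (x - t) :=
    fun v x => (integrable_coneProfile η q₀ q v).comp_sub_left x
  rw [average, setIntegral_congr_fun hQm hpt, integral_finsetSum _ fun v _ =>
    (integrable_finsetSum _ fun x _ => hint v x).integrableOn, Finset.mul_sum,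
    ← Finset.sum_sub_distrib, Finset.sum_mul]
  refine (Finset.abs_sum_le_sum_abs _ _).trans (Finset.sum_le_sum fun v hv => ?_)
  refine abs_average_sum_sub_le (hΩ.isDelone ω.1 ω.2) hr (hsep ω.1 ω.2) hQ hQm (Y v)
    (by rw [hY]; exact mem_insert _ _) (hs2 v hv) (integrable_coneProfile η q₀ q v)
    (fun z hz => (norm_lt_of_coneProfile_ne_zero hz).trans_le hs1) _ fun x => ?_
  rw [Finset.mem_filter, hSmem, hY]
  simp only [shift, image_insert_eq, zero_add, insert_subset_iff, ← range_comp, range_subset_iff,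
    Function.comp_apply, SetLike.mem_coe, add_comm x]
  tauto

/-! ### Frequencies from unique ergodicity -/

/-- The number of occurrences of `P` in `ω ∧ Q` per unit volume. -/
def frequency (hΩ : IsDDS Ω) (P : PatternClass d) {Q : Set (E d)} (hQ : Bornology.IsBounded Q)
    (ω : Ω) : ℝ :=
  (volume Q).toReal⁻¹ * (P.occurrences (wedge (ω.1 : Set (E d)) (hΩ.isDelone ω.1 ω.2) Q hQ) : ℝ)

/-- The pattern with points `0` and `v i`, supported on its points. -/
def configuration {ι : Type*} [Finite ι] (v : ι → E d) : Pattern d where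
  points := insert 0 (range v)
  support := insert 0 (range v)
  finite := (finite_range v).insert 0
  isBounded := ((finite_range v).insert 0).isBounded
  subset := Subset.rfl

theorem exists_representative_zero_mem (P : PatternClass d) (hP : P.HasPoint) :
    ∃ X : Pattern d, (0 : E d) ∈ X.points ∧ P = Quotient.mk (patternSetoid d) X := by
  induction P using Quotient.inductionOn with
  | h X =>
    obtain ⟨x, hx⟩ : X.points.Nonempty := hP
    refine ⟨⟨shift (-x) X.points, shift (-x) X.support, X.finite.image _, ?_,
      image_mono X.subset⟩, ⟨x, hx, add_neg_cancel x⟩, Quotient.sound ⟨x, ?_, ?_⟩⟩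
    · exact (LipschitzWith.isBounded_image (isometry_add_right (-x)).lipschitz X.isBounded)
    · simp [shift_shift, shift_zero]
    · simp [shift_shift, shift_zero]

/-- For small `η`, the averages of a suitable `coneProd` single out one pattern: no configuration
of differences other than the given one is compatible with the supports of the cones. -/
theorem exists_abs_average_sub_frequency_le (hΩ : IsDDSF Ω) (P : PatternClass d)
    (hP : P.HasPoint) : ∃ (g : C(Ω, ℝ)) (K C s : ℝ), 0 < K ∧ 0 < s ∧
      ∀ (ω : Ω) (Q : Set (E d)) (hQ : Bornology.IsBounded Q), MeasurableSet Q →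
        |average hΩ.toIsDDS Q g ω - K * frequency hΩ.toIsDDS P hQ ω| ≤
          C * boundaryRatio Q s := by
  classical
  obtain ⟨X, h0, rfl⟩ := exists_representative_zero_mem P hP
  obtain ⟨r, hr, hsep⟩ := hΩ.exists_separation
  have : Fintype X.points := X.finite.fintype
  set q : X.points → E d := Subtype.val with hq
  obtain ⟨M, hM⟩ : ∃ M, ∀ i, ‖q i‖ ≤ M := by
    obtain ⟨M, hM⟩ := (finite_range fun i => ‖q i‖).bddAbove
    exact ⟨M, fun i => hM ⟨i, rfl⟩⟩
  -- `D` has to be chosen before `η`, so `ρ` only uses `η ≤ 1`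
  set ρ := M + 2 with hρdef
  set D := (hΩ.finite_differences ρ).toFinset ∪ X.finite.toFinset with hDdef
  have hD : ∀ ω ∈ Ω, ∀ x ∈ ω, ∀ z : E d, x + z ∈ ω → ‖z‖ ≤ ρ → z ∈ D := by
    intro ω hω x hx z hxz hz
    refine Finset.mem_union_left _ ((Set.Finite.mem_toFinset _).2 ⟨hz, ω, hω, x, hx, hxz⟩)
  obtain ⟨δ, hδ, hδD⟩ : ∃ δ : ℝ, 0 < δ ∧ ∀ i, ∀ z ∈ D, z ≠ q i → δ ≤ ‖q i - z‖ := by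
    have hopen : ∀ i, ∃ δ : ℝ, 0 < δ ∧ ∀ z ∈ D, z ≠ q i → δ ≤ ‖q i - z‖ := by
      intro i
      obtain ⟨δ, hδ, hball⟩ := Metric.isOpen_iff.1
        (D.erase (q i)).finite_toSet.isClosed.isOpen_compl (q i) (by simp)
      refine ⟨δ, hδ, fun z hz hzq => ?_⟩
      by_contra! hlt
      have hzb : z ∈ Metric.ball (q i) δ := by
        rwa [Metric.mem_ball, dist_comm, dist_eq_norm]
      exact hball hzb (Finset.mem_coe.2 (Finset.mem_erase.2 ⟨hzq, hz⟩))
    choose δ hδ hδD using hopen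
    have hne : (Finset.univ : Finset X.points).Nonempty := ⟨⟨0, h0⟩, Finset.mem_univ _⟩
    refine ⟨Finset.univ.inf' hne δ, (Finset.lt_inf'_iff _).2 fun i _ => hδ i,
      fun i z hz hzq => (Finset.inf'_le _ (Finset.mem_univ i)).trans (hδD i z hz hzq)⟩
  -- below `r / 2` a cone sees one point, below `δ / 2` it tells apart the differences in `D`
  set η := min 1 (min (r / 2) (δ / 2)) with hηdef
  have hη0 : 0 < η := lt_min one_pos (lt_min (half_pos hr) (half_pos hδ))
  have hη1 : η ≤ 1 := min_le_left _ _
  have hηr : η ≤ r / 2 := (min_le_right _ _).trans (min_le_left _ _)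
  have hηδ : η ≤ δ / 2 := (min_le_right _ _).trans (min_le_right _ _)
  have hY : ∀ v, (if v = q then X else configuration v).points = insert 0 (range v) := by
    intro v
    split_ifs with hv
    · rw [hv, hq, Subtype.range_coe, insert_eq_of_mem h0]
    · rfl
  obtain ⟨C, s, hs, hC⟩ := exists_abs_average_coneProd_sub_le hΩ hr hsep hη0 (by linarith)
    0 q (ρ := ρ) (fun i => by rw [sub_zero, hρdef]; linarith [hM i]) D hD _ hY
  refine ⟨coneProd hΩ.toIsDDS η 0 q, ∫ z, coneProfile η 0 q q z, C, s, ?_, hs,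
    fun ω Q hQ hQm => ?_⟩
  · refine (continuous_coneProfile η 0 q q).integral_pos_of_hasCompactSupport_nonneg_nonzero
      (hasCompactSupport_coneProfile η 0 q q) (coneProfile_nonneg η 0 q q) (x := 0) ?_
    have : cone η 0 ≠ 0 := by
      rw [cone, sub_zero, max_eq_right hη0.le]
      exact hη0.ne'
    simp [coneProfile, this]
  · have h := hC ω Q hQ hQm
    rw [Finset.sum_eq_single_of_mem q
      (Fintype.mem_piFinset.2 fun i => Finset.mem_union_right _ (by simp [hq]))] at h
    · rwa [if_pos rfl] at h
    · intro v hv hvq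
      obtain ⟨i, hi⟩ := Function.ne_iff.1 hvq
      have hzero : ∀ z, coneProfile η 0 q v z = 0 := by
        intro z
        by_contra hz
        obtain ⟨h1, h2⟩ := norm_sub_lt_of_coneProfile_ne_zero hz
        have h3 := hδD i (v i) (Fintype.mem_piFinset.1 hv i) hi
        have h4 := norm_sub_le (q i - (z + v i)) (0 - z)
        rw [show q i - (z + v i) - (0 - z) = q i - v i by abel] at h4
        linarith [h2 i]
      simp [hzero]

theorem tendstoUniformly_frequency_of_uniquelyErgodic (hΩ : IsDDSF Ω)
    (h : hΩ.toIsDDS.UniquelyErgodic) (P : PatternClass d) (hP : P.HasPoint)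
    {Q : ℕ → Set (E d)} (hQ : IsVanHove Q) :
    ∃ c : ℝ, TendstoUniformly
      (fun n ω => frequency hΩ.toIsDDS P (hQ.isBounded n) ω) (fun _ => c) atTop := by
  obtain ⟨g, K, C, s, hK, hs, hC⟩ := exists_abs_average_sub_frequency_le hΩ P hP
  obtain ⟨c, hc⟩ := tendstoUniformly_average_of_uniquelyErgodic hΩ.toIsDDS h hQ g
  refine ⟨c / K, Metric.tendstoUniformly_iff.2 fun ε hε => ?_⟩
  have hb : Tendsto (fun n => C * boundaryRatio (Q n) s) atTop (𝓝 0) := by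
    simpa using (hQ.tendsto_boundaryRatio hs).const_mul C
  have hKε : 0 < K * ε / 2 := by positivity
  filter_upwards [Metric.tendstoUniformly_iff.1 hc _ hKε, hb.eventually_lt_const hKε]
    with n h1 h2 ω
  have h1' := h1 ω
  have h3 := hC ω (Q n) (hQ.isBounded n) (hQ.measurableSet n)
  rw [Real.dist_eq] at h1' ⊢
  set f := frequency hΩ.toIsDDS P (hQ.isBounded n) ω
  have e : c / K - f = K⁻¹ * (c - K * f) := by field_simp
  rw [e, abs_mul, abs_of_pos (inv_pos.2 hK), inv_mul_lt_iff₀ hK]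
  have h4 := abs_sub_le c (average hΩ.toIsDDS (Q n) g ω) (K * f)
  linarith

/-! ### Unique ergodicity from frequencies -/

/-- If the averages of `g` converge uniformly to `c`, then `c` is the integral of `g` with respect
to every invariant probability measure. -/
theorem integral_eq_of_tendstoUniformly_average (hΩ : IsDDS Ω) {Q : ℕ → Set (E d)}
    (hQ : IsVanHove Q) {μ : Measure Ω} (hμ : IsInvariantProbability hΩ μ) (g : C(Ω, ℝ)) {c : ℝ}
    (h : TendstoUniformly (fun n ω => average hΩ (Q n) g ω) (fun _ => c) atTop) :
    ∫ ω, g ω ∂μ = c := by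
  have := hμ.1
  have := hΩ.compactSpace
  have := hΩ.metrizableSpace
  refine eq_of_forall_dist_le fun ε hε => ?_
  obtain ⟨n, hn⟩ := (Metric.tendstoUniformly_iff.1 h ε hε).exists
  have hint : Integrable g μ := Integrable.of_bound g.continuous.aestronglyMeasurable ‖g‖
    (Eventually.of_forall fun ω => g.norm_coe_le_norm ω)
  have h1 := integral_average hΩ (hQ.isBounded n) (hQ.toReal_pos n) μ hμ.2
    (g + ContinuousMap.const Ω (-c))
  -- applied to `g - c`, so that integrability of the averages in `ω` is not needed
  have h2 : ∫ ω, (g + ContinuousMap.const Ω (-c)) ω ∂μ = (∫ ω, g ω ∂μ) - c := by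
    simp only [ContinuousMap.add_apply, ContinuousMap.const_apply]
    rw [integral_add hint (integrable_const _), integral_const]
    simp [sub_eq_add_neg]
  rw [Real.dist_eq, ← h2, ← h1, ← Real.norm_eq_abs]
  refine (norm_integral_le_of_norm_le_const (C := ε) (Eventually.of_forall fun ω => ?_)).trans
    (by simp)
  have h3 := hn ω
  rw [dist_comm, Real.dist_eq] at h3
  have e : average hΩ (Q n) ⇑(g + ContinuousMap.const Ω (-c)) ω = average hΩ (Q n) g ω - c := by
    rw [ContinuousMap.coe_add, average_add hΩ (hQ.isBounded n), sub_eq_add_neg]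
    congr 1
    exact average_const hΩ (hQ.toReal_pos n) (-c) ω
  rw [e, Real.norm_eq_abs]
  exact h3.le

/-- If all patterns have uniform frequencies, the integral of `coneProd` is the same for all
invariant probability measures. -/
theorem integral_coneProd_eq {ι : Type*} [Fintype ι] [DecidableEq ι] (hΩ : IsDDSF Ω) {r η : ℝ}
    (hr : 0 < r) (hsep : ∀ ω ∈ Ω, ∀ x ∈ ω, ∀ y ∈ ω, x ≠ y → r ≤ ‖x - y‖) (hη : 0 < η)
    (hηr : 2 * η ≤ r) {Q : ℕ → Set (E d)} (hQ : IsVanHove Q)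
    (h : ∀ P : PatternClass d, P.HasPoint → ∃ c : ℝ, TendstoUniformly
      (fun n ω => frequency hΩ.toIsDDS P (hQ.isBounded n) ω) (fun _ => c) atTop)
    (q₀ : E d) (q : ι → E d) {μ ν : Measure Ω} (hμ : IsInvariantProbability hΩ.toIsDDS μ)
    (hν : IsInvariantProbability hΩ.toIsDDS ν) :
    ∫ ω, coneProd hΩ.toIsDDS η q₀ q ω ∂μ = ∫ ω, coneProd hΩ.toIsDDS η q₀ q ω ∂ν := by
  obtain ⟨ρ, hρ⟩ : ∃ ρ, ∀ i, ‖q i - q₀‖ + 2 * η ≤ ρ := by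
    obtain ⟨ρ, hρ⟩ := (finite_range fun i => ‖q i - q₀‖ + 2 * η).bddAbove
    exact ⟨ρ, fun i => hρ ⟨i, rfl⟩⟩
  set D := (hΩ.finite_differences ρ).toFinset
  have hD : ∀ ω ∈ Ω, ∀ x ∈ ω, ∀ z : E d, x + z ∈ ω → ‖z‖ ≤ ρ → z ∈ D :=
    fun ω hω x hx z hxz hz => (Set.Finite.mem_toFinset _).2 ⟨hz, ω, hω, x, hx, hxz⟩
  obtain ⟨C, s, hs, hC⟩ := exists_abs_average_coneProd_sub_le hΩ hr hsep hη hηr q₀ q hρ D hD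
    configuration fun _ => rfl
  have hfreq : ∀ v : ι → E d, ∃ c : ℝ, TendstoUniformly
      (fun n ω => frequency hΩ.toIsDDS (Quotient.mk (patternSetoid d) (configuration v))
        (hQ.isBounded n) ω) (fun _ => c) atTop :=
    fun v => h _ ⟨0, mem_insert _ _⟩
  choose c hc using hfreq
  set V := Fintype.piFinset fun _ : ι => D
  set K : (ι → E d) → ℝ := fun v => ∫ z, coneProfile η q₀ q v z
  suffices hlim : TendstoUniformly
      (fun n ω => average hΩ.toIsDDS (Q n) (coneProd hΩ.toIsDDS η q₀ q) ω)
      (fun _ => ∑ v ∈ V, K v * c v) atTop by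
    rw [integral_eq_of_tendstoUniformly_average hΩ.toIsDDS hQ hμ _ hlim,
      integral_eq_of_tendstoUniformly_average hΩ.toIsDDS hQ hν _ hlim]
  refine Metric.tendstoUniformly_iff.2 fun ε hε => ?_
  set L := ∑ v ∈ V, |K v|
  have hL : 0 ≤ L := Finset.sum_nonneg fun v _ => abs_nonneg _
  have hδ : 0 < ε / (2 * (L + 1)) := by positivity
  have hb : Tendsto (fun n => C * boundaryRatio (Q n) s) atTop (𝓝 0) := by
    simpa using (hQ.tendsto_boundaryRatio hs).const_mul C
  filter_upwards [hb.eventually_lt_const (half_pos hε), (Filter.eventually_all_finset V).2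
    fun v _ => Metric.tendstoUniformly_iff.1 (hc v) _ hδ] with n h1 h2 ω
  have h3 := hC ω (Q n) (hQ.isBounded n) (hQ.measurableSet n)
  set f : (ι → E d) → ℝ := fun v => frequency hΩ.toIsDDS
    (Quotient.mk (patternSetoid d) (configuration v)) (hQ.isBounded n) ω
  have h3' : |average hΩ.toIsDDS (Q n) (coneProd hΩ.toIsDDS η q₀ q) ω - ∑ v ∈ V, K v * f v| ≤
      C * boundaryRatio (Q n) s := h3
  have h4 : |(∑ v ∈ V, K v * c v) - ∑ v ∈ V, K v * f v| ≤ L * (ε / (2 * (L + 1))) := by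
    rw [← Finset.sum_sub_distrib, Finset.sum_mul]
    refine (Finset.abs_sum_le_sum_abs _ _).trans (Finset.sum_le_sum fun v hv => ?_)
    rw [← mul_sub, abs_mul]
    exact mul_le_mul_of_nonneg_left (h2 v hv ω).le (abs_nonneg _)
  have h5 : L * (ε / (2 * (L + 1))) ≤ ε / 2 := by
    rw [mul_div_assoc', div_le_div_iff₀ (by positivity) two_pos]
    nlinarith
  rw [Real.dist_eq]
  have h6 := abs_sub_le (∑ v ∈ V, K v * c v) (∑ v ∈ V, K v * f v)
    (average hΩ.toIsDDS (Q n) (coneProd hΩ.toIsDDS η q₀ q) ω)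
  rw [abs_sub_comm (∑ v ∈ V, K v * f v)] at h6
  linarith

theorem separatesPoints_adjoin_coneAt (hΩ : IsDDS Ω) {η : ℝ} (hη : 0 < η) :
    (Algebra.adjoin ℝ (range (coneAt hΩ η))).SeparatesPoints := by
  have key : ∀ (F G : Ω) (x : E d), x ∈ F.1 → x ∉ G.1 →
      coneAt hΩ η x F ≠ coneAt hΩ η x G := by
    intro F G x hxF hxG
    have h1 : Metric.infDist x (F.1 : Set (E d)) = 0 := Metric.infDist_zero_of_mem hxF
    have h2 : 0 < Metric.infDist x (G.1 : Set (E d)) :=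
      (G.1.isClosed_coe.notMem_iff_infDist_pos (hΩ.isDelone G.1 G.2).nonempty).1 hxG
    simp only [coneAt, ContinuousMap.coe_mk, h1, cone, sub_zero]
    rw [max_eq_right hη.le]
    exact (max_lt hη (by linarith)).ne'
  intro F G hFG
  have hex : ∃ x, ¬ (x ∈ F.1 ↔ x ∈ G.1) := by
    by_contra! hno
    exact hFG (Subtype.ext (SetLike.ext hno))
  obtain ⟨x, hx⟩ := hex
  refine ⟨coneAt hΩ η x, ⟨_, Algebra.subset_adjoin ⟨x, rfl⟩, rfl⟩, ?_⟩
  by_cases hxF : x ∈ F.1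
  · exact key F G x hxF fun hxG => hx ⟨fun _ => hxG, fun _ => hxF⟩
  · exact (key G F x (by tauto) hxF).symm

theorem exists_eq_prod_coneAt (hΩ : IsDDS Ω) (η : ℝ) (l : List C(Ω, ℝ))
    (hl : ∀ g ∈ l, g ∈ range (coneAt hΩ η)) :
    ∃ (n : ℕ) (q : Fin n → E d), l.prod = ∏ i, coneAt hΩ η (q i) := by
  induction l with
  | nil => exact ⟨0, Fin.elim0, by simp⟩
  | cons g l ih =>
    obtain ⟨n, q, hq⟩ := ih fun g hg => hl g (List.mem_cons_of_mem _ hg)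
    obtain ⟨x, rfl⟩ := hl g List.mem_cons_self
    exact ⟨n + 1, Fin.cons x q, by simp [Fin.prod_univ_succ, hq]⟩

/-- By the Stone-Weierstrass theorem an invariant probability measure is determined by the
integrals of the products of cones. -/
theorem eq_of_integral_coneProd_eq (hΩ : IsDDS Ω) {η : ℝ} (hη : 0 < η) {μ ν : Measure Ω}
    [IsProbabilityMeasure μ] [IsProbabilityMeasure ν]
    (h : ∀ (n : ℕ) (q₀ : E d) (q : Fin n → E d),
      ∫ ω, coneProd hΩ η q₀ q ω ∂μ = ∫ ω, coneProd hΩ η q₀ q ω ∂ν) : μ = ν := by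
  have := hΩ.compactSpace
  have := hΩ.metrizableSpace
  have hint : ∀ (κ : Measure Ω) [IsProbabilityMeasure κ] (g : C(Ω, ℝ)), Integrable g κ :=
    fun κ _ g => Integrable.of_bound g.continuous.aestronglyMeasurable ‖g‖
      (Eventually.of_forall fun ω => g.norm_coe_le_norm ω)
  have hadj : ∀ a ∈ Algebra.adjoin ℝ (range (coneAt hΩ η)), ∫ ω, a ω ∂μ = ∫ ω, a ω ∂ν := by
    intro a ha
    rw [← Subalgebra.mem_toSubmodule, Algebra.adjoin_eq_span] at ha
    induction ha using Submodule.span_induction with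
    | mem a ha =>
      obtain ⟨l, hl, rfl⟩ := Submonoid.exists_list_of_mem_closure ha
      obtain ⟨n, q, hq⟩ := exists_eq_prod_coneAt hΩ η l hl
      rw [hq]
      cases n with
      | zero => simp
      | succ n =>
        rw [Fin.prod_univ_succ]
        exact h n (q 0) fun i => q i.succ
    | zero => simp
    | add a b _ _ iha ihb =>
      simp only [ContinuousMap.add_apply]
      rw [integral_add (hint μ a) (hint μ b), integral_add (hint ν a) (hint ν b), iha, ihb]
    | smul c a _ iha =>
      simp only [ContinuousMap.smul_apply, integral_smul, iha]
  refine measure_ext_of_integral_eq hΩ fun g => eq_of_forall_dist_le fun ε hε => ?_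
  obtain ⟨⟨a, ha⟩, hag⟩ := ContinuousMap.exists_mem_subalgebra_near_continuousMap_of_separatesPoints
    (Algebra.adjoin ℝ (range (coneAt hΩ η))) (separatesPoints_adjoin_coneAt hΩ hη) g (ε / 2)
    (half_pos hε)
  have hnear : ∀ (κ : Measure Ω) [IsProbabilityMeasure κ],
      |(∫ ω, a ω ∂κ) - ∫ ω, g ω ∂κ| ≤ ε / 2 := by
    intro κ _
    rw [← integral_sub (hint κ a) (hint κ g), ← Real.norm_eq_abs]
    refine (norm_integral_le_of_norm_le_const (C := ε / 2)
      (Eventually.of_forall fun ω => ?_)).trans (by simp)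
    exact ((a - g).norm_coe_le_norm ω).trans hag.le
  have h1 := hnear μ
  have h2 := hnear ν
  rw [hadj a ha] at h1
  rw [Real.dist_eq]
  have h3 := abs_sub_le (∫ ω, g ω ∂μ) (∫ ω, a ω ∂ν) (∫ ω, g ω ∂ν)
  rw [abs_sub_comm] at h1
  linarith

theorem uniquelyErgodic_of_tendstoUniformly_frequency (hΩ : IsDDSF Ω) (hne : Ω.Nonempty)
    {Q : ℕ → Set (E d)} (hQ : IsVanHove Q)
    (h : ∀ P : PatternClass d, P.HasPoint → ∃ c : ℝ, TendstoUniformly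
      (fun n ω => frequency hΩ.toIsDDS P (hQ.isBounded n) ω) (fun _ => c) atTop) :
    hΩ.toIsDDS.UniquelyErgodic := by
  obtain ⟨r, hr, hsep⟩ := hΩ.exists_separation
  obtain ⟨μ, hμ⟩ := exists_invariant hΩ.toIsDDS hne
  refine ⟨μ, hμ, fun ν hν => ?_⟩
  have := hμ.1
  have := hν.1
  exact eq_of_integral_coneProd_eq hΩ.toIsDDS (half_pos hr) fun n q₀ q =>
    integral_coneProd_eq hΩ hr hsep (half_pos hr) (by linarith) hQ h q₀ q hν hμ

end DeloneDyn

end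

open DeloneDyn
theorem mainTheorem1 {d : ℕ} (Ω : Set (ClosedSubset d)) (hΩ : IsDDSF Ω) (hne : Ω.Nonempty) :
    hΩ.toIsDDS.UniquelyErgodic ↔
      ∀ P : PatternClass d, P.HasPoint →
        ∀ (Q : ℕ → Set (E d)) (hQ : IsVanHove Q),
          ∃ c : ℝ, TendstoUniformly
            (fun (n : ℕ) (ω : Ω) =>
              (volume (Q n)).toReal⁻¹ *
                (P.occurrences
                  (wedge (ω.1 : Set (E d)) (hΩ.isDelone ω.1 ω.2) (Q n) (hQ.isBounded n)) : ℝ))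
            (fun _ => c) atTop := by
  constructor
  · intro h P hP Q hQ
    exact tendstoUniformly_frequency_of_uniquelyErgodic hΩ h P hP hQ
  · intro h
    exact uniquelyErgodic_of_tendstoUniformly_frequency hΩ hne isVanHove_closedBall
      fun P hP => h P hP _ isVanHove_closedBall
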